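/- There are constants $C,\alpha>0$ and a randomized polynomial-time algorithm such that the following holds for all integers $m,n,k$ with $1\le k\le n$ and all real $p>0$. Put $$X=\frac{m\,k\,p\,\log m}{n},\qquad t=\max\Big\{0,\ \frac{\log X+\log\log m}{\log\log (X+\log m)}\Big\},$$ and suppose that $X+\log m>e$, so that the denominator is positive (this holds for all $m\ge 16$). Let $A$ be a random $m\times n$ matrix with entries in $\{0,1\}$ whose rows are independent, each row being uniformly distributed among the $0$-$1$ rows with exactly $k$ ones. Call $(c,x')$ admissible for $A$ if $c,x'\in\mathbb R^n$ satisfy $\frac1p\le c_i\le 1$ and $0\le x'_i\le 1$ for all $i$, and $(Ax')_j\le 1$ for $1\le j\le m$; write $\mathrm{OPT}=\sum_i c_ix'_i$. (1) With probability at least $1-\frac1m$ over $A$, for every admissible $(c,x')$ there is $\hat x\in\{0,1\}^n$ with $$\|A\hat x\|_\infty\le C\,t\qquad\text{and}\qquad \sum_i c_i\hat x_i\ \ge\ \alpha\cdot \mathrm{OPT}.$$ (2) Such an $\hat x$ is found by the algorithm: its running time on input $(A,c,x')$ with rational $c,x'$ is bounded, for all outcomes of its coin tosses, by a fixed polynomial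 in the bit length of the input; and if for every $A$ with exactly $k$ ones in each row a rational admissible pair $(c,x')=(c(A),x'(A))$ is given, then with probability at least $1-\frac1m$ over $A$ and the coin tosses of the algorithm, its output on $(A,c,x')$ is a vector $\hat x\in\{0,1\}^n$ with the two properties in (1). -/

import Mathlib

open MeasureTheory ProbabilityTheory Matrix

/-! ### The random matrix -/

/-- `0`-`1` matrices, stored as Boolean tables. -/
abbrev BoolMat (m n : ℕ) : Type := Fin m → Fin n → Bool

/-- The matrix with real entries `0`, `1`. -/
def BoolMat.toReal {m n : ℕ} (A : BoolMat m n) : Matrix (Fin m) (Fin n) ℝ :=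
  Matrix.of fun i j => if A i j then 1 else 0

/-- The rows of length `n` with exactly `k` ones. -/
def rowsWith (n k : ℕ) : Set (Fin n → Bool) :=
  {r | (Finset.univ.filter fun j => r j = true).card = k}

/-- The law of the random `m × n` matrix: the rows are independent, and each of them is uniformly
distributed on the `0`-`1` rows with exactly `k` ones. -/
noncomputable def randomMatrix (m n k : ℕ) : Measure (BoolMat m n) :=
  Measure.pi fun _ : Fin m => uniformOn (rowsWith n k)

/-! ### Feasible fractional points and good roundings -/

/-- The weights lie in `[1/p, 1]`, the point `x` lies in `[0,1]^n` and `A x ≤ 1`. -/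
def Feasible {m n : ℕ} (A : BoolMat m n) (p : ℝ) (c x : Fin n → ℝ) : Prop :=
  (∀ j, 1 / p ≤ c j ∧ c j ≤ 1) ∧ (∀ j, 0 ≤ x j ∧ x j ≤ 1) ∧ ∀ i, (A.toReal *ᵥ x) i ≤ 1

/-- The quantity `m k p log m / n`. -/
noncomputable def load (m n k : ℕ) (p : ℝ) : ℝ :=
  (m : ℝ) * k * p * Real.log m / n

/-- The positive part of
`(log (m k p log m / n) + log log m) / log log (m k p log m / n + log m)`. -/
noncomputable def errorBound (m n k : ℕ) (p : ℝ) : ℝ :=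
  max 0 ((Real.log (load m n k p) + Real.log (Real.log m)) /
    Real.log (Real.log (load m n k p + Real.log m)))

/-- `y` is a `0`-`1` vector with `‖A y‖_∞ ≤ e` (the norm of `Fin m → ℝ` is the maximum norm) and
with objective value at least `α` times that of `x`. -/
def IsGoodRounding {m n : ℕ} (A : BoolMat m n) (e α : ℝ) (c x y : Fin n → ℝ) : Prop :=
  (∀ j, y j = 0 ∨ y j = 1) ∧ ‖A.toReal *ᵥ y‖ ≤ e ∧ α * (c ⬝ᵥ x) ≤ c ⬝ᵥ y

/-! ### Randomized algorithms: a random access machine with logarithmic cost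

The memory consists of arrays of rational numbers; programs are built from assignments, coin
tosses, sequencing, branching and while-loops. Every evaluation of a subexpression is charged the
bit length of its value, so that running times agree, up to polynomials, with those of
(probabilistic) Turing machines. -/

/-- The bit length of a rational number. -/
def bitLength (q : ℚ) : ℕ := Nat.size q.num.natAbs + Nat.size q.den + 1

/-- `M a i` is cell `i` of array `a`. -/
abbrev Memory : Type := ℕ → ℕ → ℚ

/-- Arithmetic expressions. -/
inductive Expr : Type
  | const (q : ℚ)
  | get (a : ℕ) (i : Expr)
  | add (e f : Expr)
  | sub (e f : Expr)
  | mul (e f : Expr)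
  | div (e f : Expr)
  | lt (e f : Expr)

/-- The value of an expression; an index is rounded down to a natural number, and a comparison has
the value `1` or `0`. -/
def Expr.eval (M : Memory) : Expr → ℚ
  | .const q => q
  | .get a i => M a ⌊i.eval M⌋₊
  | .add e f => e.eval M + f.eval M
  | .sub e f => e.eval M - f.eval M
  | .mul e f => e.eval M * f.eval M
  | .div e f => e.eval M / f.eval M
  | .lt e f => if e.eval M < f.eval M then 1 else 0

/-- The cost of evaluating an expression: the bit lengths of the values of all subexpressions. -/
def Expr.cost (M : Memory) : Expr → ℕ
  | .const q => bitLength q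
  | .get a i => i.cost M + bitLength ((Expr.get a i).eval M)
  | .add e f => e.cost M + f.cost M + bitLength ((Expr.add e f).eval M)
  | .sub e f => e.cost M + f.cost M + bitLength ((Expr.sub e f).eval M)
  | .mul e f => e.cost M + f.cost M + bitLength ((Expr.mul e f).eval M)
  | .div e f => e.cost M + f.cost M + bitLength ((Expr.div e f).eval M)
  | .lt e f => e.cost M + f.cost M + bitLength ((Expr.lt e f).eval M)

/-- Programs. -/
inductive Prog : Type
  | skip
  | assign (a : ℕ) (i e : Expr)
  | toss (a : ℕ) (i : Expr)
  | seq (P Q : Prog)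
  | ite (b : Expr) (P Q : Prog)
  | while (b : Expr) (P : Prog)

/-- A configuration: the memory and the number of coins tossed so far. -/
structure Config : Type where
  mem : Memory
  used : ℕ

/-- Write `q` into cell `i` of array `a`. -/
def Memory.write (M : Memory) (a i : ℕ) (q : ℚ) : Memory :=
  fun a' i' => if a' = a ∧ i' = i then q else M a' i'

/-- `Run ω P s t s'`: with coin tosses `ω`, the program `P` started in `s` halts in `s'` after
`t` steps. -/
inductive Run (ω : ℕ → Bool) : Prog → Config → ℕ → Config → Prop
  | skip (s : Config) : Run ω .skip s 1 s
  | assign (a : ℕ) (i e : Expr) (s : Config) :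
      Run ω (.assign a i e) s (i.cost s.mem + e.cost s.mem + 1)
        ⟨Memory.write s.mem a ⌊i.eval s.mem⌋₊ (e.eval s.mem), s.used⟩
  | toss (a : ℕ) (i : Expr) (s : Config) :
      Run ω (.toss a i) s (i.cost s.mem + 1)
        ⟨Memory.write s.mem a ⌊i.eval s.mem⌋₊ (if ω s.used then 1 else 0), s.used + 1⟩
  | seq {P Q : Prog} {s₀ s₁ s₂ : Config} {t₁ t₂ : ℕ} :
      Run ω P s₀ t₁ s₁ → Run ω Q s₁ t₂ s₂ → Run ω (.seq P Q) s₀ (t₁ + t₂ + 1) s₂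
  | ite_pos {b : Expr} {P Q : Prog} {s s' : Config} {t : ℕ} :
      b.eval s.mem ≠ 0 → Run ω P s t s' → Run ω (.ite b P Q) s (b.cost s.mem + t + 1) s'
  | ite_neg {b : Expr} {P Q : Prog} {s s' : Config} {t : ℕ} :
      b.eval s.mem = 0 → Run ω Q s t s' → Run ω (.ite b P Q) s (b.cost s.mem + t + 1) s'
  | while_done {b : Expr} {P : Prog} {s : Config} :
      b.eval s.mem = 0 → Run ω (.while b P) s (b.cost s.mem + 1) s
  | while_step {b : Expr} {P : Prog} {s₀ s₁ s₂ : Config} {t₁ t₂ : ℕ} :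
      b.eval s₀.mem ≠ 0 → Run ω P s₀ t₁ s₁ → Run ω (.while b P) s₁ t₂ s₂ →
        Run ω (.while b P) s₀ (b.cost s₀.mem + t₁ + t₂ + 1) s₂

/-- The input `(A, c, x)`: array `0` holds `m` and `n`, array `1` holds `A` row by row, arrays `2`
and `3` hold `c` and `x`; everything else is `0`. -/
def inputMemory {m n : ℕ} (A : BoolMat m n) (c x : Fin n → ℚ) : Memory := fun a l =>
  match a with
  | 0 => if l = 0 then (m : ℚ) else if l = 1 then (n : ℚ) else 0
  | 1 => if h : l < m * n then
      (if A (finProdFinEquiv.symm ⟨l, h⟩).1 (finProdFinEquiv.symm ⟨l, h⟩).2 then 1 else 0) else 0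
  | 2 => if h : l < n then c ⟨l, h⟩ else 0
  | 3 => if h : l < n then x ⟨l, h⟩ else 0
  | _ => 0

/-- The length of the input `(A, c, x)`. -/
def inputLength {m n : ℕ} (_A : BoolMat m n) (c x : Fin n → ℚ) : ℕ :=
  m + n + m * n + ∑ j, bitLength (c j) + ∑ j, bitLength (x j)

/-- On the input `(A, c, x)` and with coin tosses `ω`, the program `P` halts after `t` steps, with
the vector `y` in array `4`. -/
def Outputs {m n : ℕ} (P : Prog) (ω : ℕ → Bool) (A : BoolMat m n) (c x : Fin n → ℚ)
    (t : ℕ) (y : Fin n → ℚ) : Prop :=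
  ∃ s : Config, Run ω P ⟨inputMemory A c x, 0⟩ t s ∧ ∀ j : Fin n, s.mem 4 j = y j

/-- There is a polynomial in the input length that bounds the running time of `P` on all inputs and
for all coin tosses. -/
def RunsInPolyTime (P : Prog) : Prop :=
  ∃ q : Polynomial ℕ, ∀ (m n : ℕ) (A : BoolMat m n) (c x : Fin n → ℚ) (ω : ℕ → Bool),
    ∃ (t : ℕ) (y : Fin n → ℚ), Outputs P ω A c x t y ∧ t ≤ q.eval (inputLength A c x)

/-- Independent fair coin tosses. -/
noncomputable def fairCoins : Measure (ℕ → Bool) :=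
  Measure.infinitePi fun _ : ℕ => uniformOn (Set.univ : Set Bool)

/-!
The rounding is deterministic and works for every matrix with at most `k` ones per row. Replace `x`
by `z = x / 2 + 1 / (2k)`: the row sums stay at most `1`, half of the objective value is kept, and
the objective value becomes at least `n / (2kp)`. Penalize the objective by `8 ^ (-s)` times the
sum over the rows `r` of `(∏ (1 + s r_l z_l) - 1) / s`. This is affine in each coordinate, so the
coordinates can be set to `0` or `1` one after the other without decreasing it, and a column is
taken only if the total weight `∏ (1 + s r_l z_l)` of the rows through it is less than `8 ^ s`. The
initial potential of a row is at most `4 ^ s`, so the initial penalty is at most `m / 2 ^ s`; with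
`2 ^ s` of order `m` over the objective value, hence at most of order `mkp / n`, half of the
objective value survives. When the last of `N + 1` taken columns in a row was considered, the
weight of this row was at least `(s + 1) ^ N`. Hence `(s + 1) ^ N < 8 ^ s`, so that `N` is at most
of order `s / log s`.

For the running time, all numbers occurring in the rounding have absolute values and denominators
at most `2 ^ h` with `h` polynomial in the input length.
-/

/-! ### Greedy rounding -/

section GreedyRounding

open Finset Function

variable {K : Type*} [Field K]

/-- The weight `∏ (1 + s r_l z_l)` of the row `r` at the point `z`, a pessimistic estimator for
the number of ones of `r` that are rounded up. Vectors are indexed by `ℕ`, and only the first `n`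
entries matter. -/
def rowWeight (r z : ℕ → K) (s n : ℕ) : K := ∏ l ∈ range n, (1 + s * (r l * z l))

/-- The telescoped form of `(rowWeight r z s n - 1) / s`, which also makes sense for `s = 0`. -/
def rowPotential (r z : ℕ → K) (s n : ℕ) : K := ∑ l ∈ range n, r l * z l * rowWeight r z s l

/-- The total weight of the rows of the `m × n` matrix `a` that contain the column `i`; it is the
slope of the total potential in the coordinate `i` when `z i = 0`. -/
def congestion (a : ℕ → ℕ → K) (z : ℕ → K) (m n s i : ℕ) : K :=
  ∑ j ∈ range m, a j i * rowWeight (a j) z s n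

/-- The objective value `∑ c_l z_l`. -/
def objective (c z : ℕ → K) (n : ℕ) : K := ∑ l ∈ range n, c l * z l

/-- The objective value minus the total potential of the rows, scaled by `8 ^ (-s)`. It is affine
in each coordinate, so each coordinate can be rounded without decreasing it. -/
def penalizedObjective (a : ℕ → ℕ → K) (c z : ℕ → K) (m n s : ℕ) : K :=
  objective c z n - (∑ j ∈ range m, rowPotential (a j) z s n) / 8 ^ s

theorem rowWeight_update_of_le (r z : ℕ → K) (s : ℕ) {i n : ℕ} (hin : n ≤ i) (q : K) :
    rowWeight r (update z i q) s n = rowWeight r z s n :=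
  prod_congr rfl fun l hl => by
    rw [update_of_ne ((mem_range.mp hl).trans_le hin).ne]

theorem rowWeight_update (r z : ℕ → K) (s : ℕ) {i n : ℕ} (hin : i < n) (q : K) :
    rowWeight r (update z i q) s n = rowWeight r (update z i 0) s n * (1 + s * (r i * q)) := by
  have factor (q : K) : (fun l => 1 + (s : K) * (r l * update z i q l)) =
      update (fun l => 1 + (s : K) * (r l * z l)) i (1 + s * (r i * q)) :=
    funext fun l => apply_update (fun l v => 1 + (s : K) * (r l * v)) z i q l
  simp only [rowWeight, factor, prod_update_of_mem (mem_range.mpr hin)]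
  ring

theorem rowPotential_update_of_le (r z : ℕ → K) (s : ℕ) {i n : ℕ} (hin : n ≤ i) (q : K) :
    rowPotential r (update z i q) s n = rowPotential r z s n :=
  sum_congr rfl fun l hl => by
    have hli : l < i := (mem_range.mp hl).trans_le hin
    rw [update_of_ne hli.ne, rowWeight_update_of_le r z s hli.le]

theorem rowPotential_update (r z : ℕ → K) (s : ℕ) {i n : ℕ} (hin : i < n) (q : K) :
    rowPotential r (update z i q) s n =
      rowPotential r (update z i 0) s n + q * (r i * rowWeight r (update z i 0) s n) := by
  have potential_succ (z : ℕ → K) (n : ℕ) :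
      rowPotential r z s (n + 1) = rowPotential r z s n + r n * z n * rowWeight r z s n :=
    sum_range_succ _ n
  have weight_succ (z : ℕ → K) (n : ℕ) :
      rowWeight r z s (n + 1) = rowWeight r z s n * (1 + s * (r n * z n)) :=
    prod_range_succ _ n
  induction n with
  | zero => omega
  | succ n ih =>
    rcases Nat.lt_succ_iff_lt_or_eq.mp hin with hin | rfl
    · rw [potential_succ, potential_succ, weight_succ, ih hin, rowWeight_update r z s hin q,
        update_of_ne hin.ne', update_of_ne hin.ne']
      ring
    · simp only [potential_succ, weight_succ, rowPotential_update_of_le r z s le_rfl,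
        rowWeight_update_of_le r z s le_rfl, update_self]
      ring

theorem objective_update (c z : ℕ → K) {i n : ℕ} (hin : i < n) (q : K) :
    objective c (update z i q) n = objective c (update z i 0) n + q * c i := by
  have term (q : K) : (fun l => c l * update z i q l) = update (fun l => c l * z l) i (c i * q) :=
    funext fun l => apply_update (fun l v => c l * v) z i q l
  simp only [objective, term, sum_update_of_mem (mem_range.mpr hin)]
  ring

theorem penalizedObjective_update (a : ℕ → ℕ → K) (c z : ℕ → K) (m s : ℕ) {i n : ℕ}
    (hin : i < n) (q : K) :
    penalizedObjective a c (update z i q) m n s =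
      penalizedObjective a c (update z i 0) m n s +
        q * (c i - congestion a (update z i 0) m n s i / 8 ^ s) := by
  simp only [penalizedObjective, congestion, objective_update c z hin q,
    rowPotential_update _ z s hin q, sum_add_distrib, ← mul_sum]
  ring

/-- The point from which the rounding starts: half of `x` plus the constant `1 / (2 k)`, which
contributes at most `1 / 2` to a row with at most `k` ones. -/
def startPoint (x : ℕ → K) (k n : ℕ) : ℕ → K :=
  fun l => if l < n then x l / 2 + 1 / (2 * k) else 0

theorem sum_mul_startPoint (r x : ℕ → K) (k n : ℕ) :
    ∑ l ∈ range n, r l * startPoint x k n l =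
      (∑ l ∈ range n, r l * x l) / 2 + (∑ l ∈ range n, r l) / (2 * k) := by
  rw [sum_div, sum_div, ← sum_add_distrib]
  refine sum_congr rfl fun l hl => ?_
  rw [startPoint, if_pos (mem_range.mp hl)]
  ring

variable [LinearOrder K]

/-- The value `0` or `1` given to the coordinate `i` of the point `z`. -/
def roundedCoordinate (a : ℕ → ℕ → K) (c : ℕ → K) (m n s : ℕ) (z : ℕ → K) (i : ℕ) : K :=
  if congestion a (update z i 0) m n s i < c i * 8 ^ s then 1 else 0

/-- The point `z` after the coordinates `0, …, i - 1` have been rounded one after the other. -/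
def roundSeq (a : ℕ → ℕ → K) (c : ℕ → K) (m n s : ℕ) (z : ℕ → K) : ℕ → ℕ → K
  | 0 => z
  | i + 1 =>
    update (roundSeq a c m n s z i) i (roundedCoordinate a c m n s (roundSeq a c m n s z i) i)

theorem roundSeq_apply_of_le (a : ℕ → ℕ → K) (c : ℕ → K) (m n s : ℕ) (z : ℕ → K) {i l : ℕ}
    (hil : i ≤ l) : roundSeq a c m n s z i l = z l := by
  induction i with
  | zero => rfl
  | succ i ih => rw [roundSeq, update_of_ne (by omega), ih (by omega)]

theorem roundSeq_apply_of_lt (a : ℕ → ℕ → K) (c : ℕ → K) (m n s : ℕ) (z : ℕ → K) {i l : ℕ}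
    (hli : l < i) :
    roundSeq a c m n s z i l = roundedCoordinate a c m n s (roundSeq a c m n s z l) l := by
  induction i with
  | zero => omega
  | succ i ih =>
    rcases Nat.lt_succ_iff_lt_or_eq.mp hli with hli | rfl
    · rw [roundSeq, update_of_ne hli.ne, ih hli]
    · rw [roundSeq, update_self]

theorem roundSeq_eq_zero_or_one (a : ℕ → ℕ → K) (c : ℕ → K) (m n s : ℕ) (z : ℕ → K) {i l : ℕ}
    (hli : l < i) : roundSeq a c m n s z i l = 0 ∨ roundSeq a c m n s z i l = 1 := by
  rw [roundSeq_apply_of_lt a c m n s z hli, roundedCoordinate]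
  exact (ite_eq_or_eq _ _ _).symm

theorem congestion_lt_of_roundSeq_eq_one {a : ℕ → ℕ → K} {c : ℕ → K} {m n s : ℕ}
    {z : ℕ → K} {i l : ℕ} (hli : l < i) (h : roundSeq a c m n s z i l = 1) :
    congestion a (update (roundSeq a c m n s z l) l 0) m n s l < c l * 8 ^ s := by
  rw [roundSeq_apply_of_lt a c m n s z hli, roundedCoordinate, ite_eq_left_iff] at h
  exact not_not.mp (mt h zero_ne_one)

/-- The least exponent `s` with `q ≤ 2 ^ s`. -/
def ceilLog [FloorSemiring K] (q : K) : ℕ := Nat.clog 2 ⌈q⌉₊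

theorem ceilLog_le_iff [FloorSemiring K] {q : K} {s : ℕ} : ceilLog q ≤ s ↔ q ≤ 2 ^ s := by
  rw [ceilLog, Nat.clog_le_iff_le_pow Nat.one_lt_two, Nat.ceil_le]
  norm_num

/-- The parameter `s` of the potentials is large enough to make the initial penalty at most half
of the initial objective value. -/
def roundingParameter [FloorSemiring K] (c x : ℕ → K) (m n k : ℕ) : ℕ :=
  ceilLog (2 * m / objective c (startPoint x k n) n)

/-- The outcome of the rounding of the fractional point `x`, for a matrix with at most `k` ones in
each row. -/
def greedyRounding [FloorSemiring K] (a : ℕ → ℕ → K) (c x : ℕ → K) (m n k : ℕ) : ℕ → K :=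
  roundSeq a c m n (roundingParameter c x m n k) (startPoint x k n) n

variable [IsStrictOrderedRing K]

theorem one_le_rowWeight {r z : ℕ → K} {s n : ℕ} (hrz : ∀ l < n, 0 ≤ r l * z l) :
    1 ≤ rowWeight r z s n :=
  one_le_prod fun l hl => by
    have := mul_nonneg (Nat.cast_nonneg' (α := K) s) (hrz l (mem_range.mp hl))
    linarith

theorem rowPotential_nonneg {r z : ℕ → K} {s n : ℕ} (hrz : ∀ l < n, 0 ≤ r l * z l) :
    0 ≤ rowPotential r z s n :=
  sum_nonneg fun l hl => by
    have hln := mem_range.mp hl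
    exact mul_nonneg (hrz l hln)
      (zero_le_one.trans (one_le_rowWeight fun i hi => hrz i (hi.trans hln)))

theorem rowPotential_le_sum_mul_rowWeight {r z : ℕ → K} {s n : ℕ}
    (hrz : ∀ l < n, 0 ≤ r l * z l) :
    rowPotential r z s n ≤ (∑ l ∈ range n, r l * z l) * rowWeight r z s n := by
  rw [rowPotential, sum_mul]
  refine sum_le_sum fun l hl => mul_le_mul_of_nonneg_left ?_ (hrz l (mem_range.mp hl))
  have factor_ge : ∀ i ∈ range n, 1 ≤ 1 + (s : K) * (r i * z i) := fun i hi =>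
    le_add_of_nonneg_right (mul_nonneg (Nat.cast_nonneg' s) (hrz i (mem_range.mp hi)))
  have hsub : range l ⊆ range n := range_mono (mem_range.mp hl).le
  exact prod_le_prod_of_subset_of_one_le hsub
    (fun i hi => zero_le_one.trans (factor_ge i (hsub hi))) fun i hi _ => factor_ge i hi

theorem pow_card_le_rowWeight {r z : ℕ → K} {s n : ℕ} {F : Finset ℕ} (hF : F ⊆ range n)
    (hrz : ∀ l < n, 0 ≤ r l * z l) (hone : ∀ l ∈ F, r l * z l = 1) :
    ((s : K) + 1) ^ #F ≤ rowWeight r z s n := by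
  have factor_eq : ∀ l ∈ F, 1 + (s : K) * (r l * z l) = s + 1 := fun l hl => by
    rw [hone l hl, mul_one, add_comm]
  rw [← prod_const, ← prod_congr rfl factor_eq]
  refine prod_le_prod_of_subset_of_one_le hF (fun l hl => ?_) fun l hl _ => ?_
  · rw [factor_eq l hl]
    positivity
  · exact le_add_of_nonneg_right (mul_nonneg (Nat.cast_nonneg' s) (hrz l (mem_range.mp hl)))

theorem one_sub_sum_mul_prod_one_add_le_one {ι : Type*} (F : Finset ι) {x : ι → K}
    (hx : ∀ i ∈ F, 0 ≤ x i) : (1 - ∑ i ∈ F, x i) * ∏ i ∈ F, (1 + x i) ≤ 1 := by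
  classical
  induction F using Finset.induction_on with
  | empty => simp
  | insert i F hi ih =>
    obtain ⟨hxi, hxF⟩ := forall_mem_insert .. |>.mp hx
    have hprod : 0 ≤ ∏ i ∈ F, (1 + x i) :=
      prod_nonneg fun i hi => add_nonneg zero_le_one (hxF i hi)
    have hsquare : 0 ≤ x i * (x i + ∑ i ∈ F, x i) * ∏ i ∈ F, (1 + x i) :=
      mul_nonneg (mul_nonneg hxi (add_nonneg hxi (sum_nonneg hxF))) hprod
    rw [sum_insert hi, prod_insert hi]
    linear_combination ih hxF + hsquare

theorem prod_one_add_le_four {ι : Type*} (F : Finset ι) {x : ι → K}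
    (hx : ∀ i ∈ F, 0 ≤ x i) (hsum : ∑ i ∈ F, x i ≤ 1) : ∏ i ∈ F, (1 + x i) ≤ 4 := by
  have half_nonneg : ∀ i ∈ F, 0 ≤ x i / 2 := fun i hi => by have := hx i hi; positivity
  have le_two : ∏ i ∈ F, (1 + x i / 2) ≤ 2 := by
    have key := one_sub_sum_mul_prod_one_add_le_one F half_nonneg
    have hprod : 0 ≤ ∏ i ∈ F, (1 + x i / 2) :=
      prod_nonneg fun i hi => by have := half_nonneg i hi; positivity
    rw [← sum_div] at key
    nlinarith
  calc ∏ i ∈ F, (1 + x i) ≤ ∏ i ∈ F, (1 + x i / 2) ^ 2 :=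
        prod_le_prod (fun i hi => by have := hx i hi; positivity) fun i _ => by
          nlinarith [sq_nonneg (x i)]
    _ = (∏ i ∈ F, (1 + x i / 2)) ^ 2 := prod_pow _ _ _
    _ ≤ 2 ^ 2 := pow_le_pow_left₀ (prod_nonneg fun i hi => by
          have := half_nonneg i hi; positivity) le_two 2
    _ = 4 := by norm_num

theorem rowWeight_le_four_pow {r z : ℕ → K} {n : ℕ} (s : ℕ) (hrz : ∀ l < n, 0 ≤ r l * z l)
    (hsum : ∑ l ∈ range n, r l * z l ≤ 1) : rowWeight r z s n ≤ 4 ^ s := by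
  have hrz' : ∀ l ∈ range n, 0 ≤ r l * z l := fun l hl => hrz l (mem_range.mp hl)
  calc rowWeight r z s n ≤ ∏ l ∈ range n, (1 + r l * z l) ^ s :=
        prod_le_prod (fun l hl => by have := hrz' l hl; positivity) fun l hl =>
          one_add_mul_le_pow (by linarith [hrz' l hl]) s
    _ = (∏ l ∈ range n, (1 + r l * z l)) ^ s := prod_pow _ _ _
    _ ≤ 4 ^ s := pow_le_pow_left₀ (prod_nonneg fun l hl => by have := hrz' l hl; positivity)
        (prod_one_add_le_four _ hrz' hsum) s

theorem rowPotential_le_four_pow {r z : ℕ → K} {n : ℕ} (s : ℕ) (hrz : ∀ l < n, 0 ≤ r l * z l)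
    (hsum : ∑ l ∈ range n, r l * z l ≤ 1) : rowPotential r z s n ≤ 4 ^ s :=
  calc rowPotential r z s n ≤ (∑ l ∈ range n, r l * z l) * rowWeight r z s n :=
        rowPotential_le_sum_mul_rowWeight hrz
    _ ≤ 1 * 4 ^ s := mul_le_mul hsum (rowWeight_le_four_pow s hrz hsum)
        (zero_le_one.trans (one_le_rowWeight hrz)) zero_le_one
    _ = 4 ^ s := one_mul _

theorem penalizedObjective_le_update_roundedCoordinate (a : ℕ → ℕ → K) (c : ℕ → K) (m s : ℕ)
    {z : ℕ → K} {i n : ℕ} (hin : i < n) (hz : z i ∈ Set.Icc 0 1) :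
    penalizedObjective a c z m n s ≤
      penalizedObjective a c (update z i (roundedCoordinate a c m n s z i)) m n s := by
  have unrounded := penalizedObjective_update a c z m s hin (z i)
  rw [update_eq_self] at unrounded
  rw [unrounded, penalizedObjective_update a c z m s hin (roundedCoordinate a c m n s z i),
    add_le_add_iff_left, roundedCoordinate]
  have threshold : congestion a (update z i 0) m n s i < c i * 8 ^ s ↔
      0 < c i - congestion a (update z i 0) m n s i / 8 ^ s := by
    rw [sub_pos, div_lt_iff₀ (by positivity)]
  split_ifs with h
  · exact mul_le_mul_of_nonneg_right hz.2 (threshold.mp h).le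
  · rw [zero_mul]
    exact mul_nonpos_of_nonneg_of_nonpos hz.1 (not_lt.mp (mt threshold.mpr h))

theorem penalizedObjective_le_roundSeq (a : ℕ → ℕ → K) (c : ℕ → K) (m s : ℕ) {z : ℕ → K}
    {i n : ℕ} (hin : i ≤ n) (hz : ∀ l < n, z l ∈ Set.Icc 0 1) :
    penalizedObjective a c z m n s ≤ penalizedObjective a c (roundSeq a c m n s z i) m n s := by
  induction i with
  | zero => rfl
  | succ i ih =>
    refine (ih (by omega)).trans (penalizedObjective_le_update_roundedCoordinate a c m s hin ?_)
    rw [roundSeq_apply_of_le a c m n s z le_rfl]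
    exact hz i hin

theorem roundSeq_nonneg (a : ℕ → ℕ → K) (c : ℕ → K) (m s : ℕ) {z : ℕ → K} {n : ℕ}
    (hz : ∀ l < n, 0 ≤ z l) (i : ℕ) : ∀ l < n, 0 ≤ roundSeq a c m n s z i l := by
  intro l hl
  rcases lt_or_ge l i with hli | hil
  · rcases roundSeq_eq_zero_or_one a c m n s z hli with h | h <;> simp [h]
  · rw [roundSeq_apply_of_le a c m n s z hil]
    exact hz l hl

section Analysis

variable {a : ℕ → ℕ → K} {c z : ℕ → K} {m n s : ℕ} (ha : ∀ j < m, ∀ l < n, 0 ≤ a j l)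
include ha

theorem objective_le_two_mul_objective_roundSeq (hz : ∀ l < n, z l ∈ Set.Icc 0 1)
    (hrow : ∀ j < m, ∑ l ∈ range n, a j l * z l ≤ 1) (hs : 2 * m ≤ 2 ^ s * objective c z n) :
    objective c z n ≤ 2 * objective c (roundSeq a c m n s z n) n := by
  have start_potential : (∑ j ∈ range m, rowPotential (a j) z s n) / 8 ^ s ≤ m / 2 ^ s := by
    have hsum : ∑ j ∈ range m, rowPotential (a j) z s n ≤ m * 4 ^ s := by
      simpa using sum_le_card_nsmul (range m) _ (4 ^ s) fun j hj =>
        rowPotential_le_four_pow s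
          (fun l hl => mul_nonneg (ha j (mem_range.mp hj) l hl) (hz l hl).1)
          (hrow j (mem_range.mp hj))
    rw [div_le_div_iff₀ (by positivity) (by positivity)]
    calc _ ≤ m * 4 ^ s * (2 : K) ^ s := by gcongr
      _ = m * 8 ^ s := by rw [mul_assoc, ← mul_pow]; norm_num
  have final_potential :
      0 ≤ (∑ j ∈ range m, rowPotential (a j) (roundSeq a c m n s z n) s n) / 8 ^ s := by
    refine div_nonneg (sum_nonneg fun j hj => rowPotential_nonneg fun l hl => ?_) (by positivity)
    exact mul_nonneg (ha j (mem_range.mp hj) l hl)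
      (roundSeq_nonneg a c m s (fun l hl => (hz l hl).1) n l hl)
  have half : (m : K) / 2 ^ s ≤ objective c z n / 2 := by
    rw [div_le_div_iff₀ (by positivity) two_pos]
    linarith
  have key := penalizedObjective_le_roundSeq a c m s le_rfl hz
  simp only [penalizedObjective] at key
  linarith

theorem rowWeight_le_congestion (hz : ∀ l < n, 0 ≤ z l) {i j : ℕ} (hi : i < n) (hj : j < m)
    (hji : a j i = 1) : rowWeight (a j) z s n ≤ congestion a z m n s i := by
  have term_nonneg : ∀ j' ∈ range m, 0 ≤ a j' i * rowWeight (a j') z s n := fun j' hj' => by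
    have ha' := ha j' (mem_range.mp hj')
    exact mul_nonneg (ha' i hi)
      (zero_le_one.trans (one_le_rowWeight fun l hl => mul_nonneg (ha' l hl) (hz l hl)))
  simpa [hji, congestion] using single_le_sum term_nonneg (mem_range.mpr hj)

theorem pow_lt_of_card_rounded_row (hz : ∀ l < n, 0 ≤ z l) (hc : ∀ l < n, c l ≤ 1) {j N : ℕ}
    (hj : j < m)
    (hN : #{l ∈ range n | a j l = 1 ∧ roundSeq a c m n s z n l = 1} = N + 1) :
    (s + 1) ^ N < 8 ^ s := by
  set F := {l ∈ range n | a j l = 1 ∧ roundSeq a c m n s z n l = 1} with hF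
  have mem_F {l : ℕ} (hl : l ∈ F) : l < n ∧ a j l = 1 ∧ roundSeq a c m n s z n l = 1 := by
    simpa [hF] using hl
  -- When the last of these columns is rounded, its congestion already sees all the others.
  obtain ⟨i, hiF, hmax⟩ := F.exists_max_image id (card_pos.mp (by omega))
  obtain ⟨hin, hji, hyi⟩ := mem_F hiF
  set y := update (roundSeq a c m n s z i) i 0 with hy
  have y_nonneg : ∀ l < n, 0 ≤ y l := fun l hl => by
    rcases eq_or_ne l i with rfl | hli
    · rw [hy, update_self]
    · rw [hy, update_of_ne hli]
      exact roundSeq_nonneg a c m s hz i l hl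
  have entry_eq_one : ∀ l ∈ F.erase i, a j l * y l = 1 := fun l hl => by
    obtain ⟨hli, hlF⟩ := mem_erase.mp hl
    obtain ⟨hln, hjl, hyl⟩ := mem_F hlF
    have hlt : l < i := lt_of_le_of_ne (hmax l hlF) hli
    rw [hjl, one_mul, hy, update_of_ne hli, roundSeq_apply_of_lt a c m n s z hlt,
      ← roundSeq_apply_of_lt a c m n s z hln, hyl]
  have key : ((s : K) + 1) ^ N < 8 ^ s := by
    calc ((s : K) + 1) ^ N = ((s : K) + 1) ^ #(F.erase i) := by
          rw [card_erase_of_mem hiF, hN, Nat.add_sub_cancel]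
      _ ≤ rowWeight (a j) y s n :=
          pow_card_le_rowWeight (fun l hl => mem_range.mpr (mem_F (mem_of_mem_erase hl)).1)
            (fun l hl => mul_nonneg (ha j hj l hl) (y_nonneg l hl)) entry_eq_one
      _ ≤ congestion a y m n s i := rowWeight_le_congestion ha y_nonneg hin hj hji
      _ < c i * 8 ^ s := congestion_lt_of_roundSeq_eq_one hin hyi
      _ ≤ 8 ^ s := mul_le_of_le_one_left (by positivity) (hc i hin)
  exact_mod_cast key

end Analysis

theorem startPoint_mem_Icc {x : ℕ → K} {k n l : ℕ} (hk : 1 ≤ k) (hx : x l ∈ Set.Icc 0 1) :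
    startPoint x k n l ∈ Set.Icc 0 1 := by
  have hshift : 1 / (2 * (k : K)) ≤ 1 / 2 := by
    have : (1 : K) ≤ k := by exact_mod_cast hk
    gcongr
    linarith
  have hshift_nonneg : 0 ≤ 1 / (2 * (k : K)) := by positivity
  rw [startPoint]
  split_ifs
  · constructor <;> linarith [hx.1, hx.2]
  · exact ⟨le_rfl, zero_le_one⟩

theorem sum_mul_startPoint_le_one {r x : ℕ → K} {k n : ℕ}
    (hcard : ∑ l ∈ range n, r l ≤ k) (hsum : ∑ l ∈ range n, r l * x l ≤ 1) :
    ∑ l ∈ range n, r l * startPoint x k n l ≤ 1 := by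
  have hhalf : (∑ l ∈ range n, r l) / (2 * k) ≤ 1 / 2 := by
    calc (∑ l ∈ range n, r l) / (2 * k) ≤ (k : K) / (2 * k) := by gcongr
      _ = (k / k) / 2 := by ring
      _ ≤ 1 / 2 := by gcongr; exact div_self_le_one _
  rw [sum_mul_startPoint]
  linarith

theorem objective_le_two_mul_objective_startPoint {c : ℕ → K} (x : ℕ → K) (k : ℕ) {n : ℕ}
    (hc : ∀ l < n, 0 ≤ c l) : objective c x n ≤ 2 * objective c (startPoint x k n) n := by
  have : 0 ≤ (∑ l ∈ range n, c l) / (2 * k) :=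
    div_nonneg (sum_nonneg fun l hl => hc l (mem_range.mp hl)) (by positivity)
  simp only [objective, sum_mul_startPoint]
  linarith

section Guarantee

variable [FloorSemiring K] {a : ℕ → ℕ → K} {c x : ℕ → K} {m n k : ℕ}

theorem two_pow_roundingParameter_mul_objective_lt (hs : roundingParameter c x m n k ≠ 0) :
    2 ^ roundingParameter c x m n k * objective c (startPoint x k n) n < 4 * m := by
  obtain ⟨s, hs⟩ := Nat.exists_eq_succ_of_ne_zero hs
  have not_le : ¬ 2 * m / objective c (startPoint x k n) n ≤ 2 ^ s := fun h => by
    have : roundingParameter c x m n k ≤ s := ceilLog_le_iff.mpr h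
    omega
  have lt_quotient : 2 ^ s < 2 * m / objective c (startPoint x k n) n := lt_of_not_ge not_le
  have hpos : 0 < objective c (startPoint x k n) n := by
    by_contra! hnonpos
    exact lt_quotient.not_ge
      ((div_nonpos_of_nonneg_of_nonpos (by positivity) hnonpos).trans (by positivity))
  rw [lt_div_iff₀ hpos] at lt_quotient
  rw [hs, pow_succ]
  linarith

theorem objective_le_four_mul_objective_greedyRounding (hk : 1 ≤ k)
    (ha : ∀ j < m, ∀ l < n, 0 ≤ a j l) (hcard : ∀ j < m, ∑ l ∈ range n, a j l ≤ k)
    (hc : ∀ l < n, 0 ≤ c l) (hx : ∀ l < n, x l ∈ Set.Icc 0 1)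
    (hax : ∀ j < m, ∑ l ∈ range n, a j l * x l ≤ 1) :
    objective c x n ≤ 4 * objective c (greedyRounding a c x m n k) n := by
  have hz : ∀ l < n, startPoint x k n l ∈ Set.Icc 0 1 := fun l hl =>
    startPoint_mem_Icc hk (hx l hl)
  have hstart := objective_le_two_mul_objective_startPoint x k hc
  rcases le_or_gt (objective c (startPoint x k n) n) 0 with hzero | hpos
  · have : 0 ≤ objective c (greedyRounding a c x m n k) n := sum_nonneg fun l hl =>
      mul_nonneg (hc l (mem_range.mp hl))
        (roundSeq_nonneg a c m _ (fun l hl => (hz l hl).1) n l (mem_range.mp hl))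
    linarith
  · have hs : 2 * m / objective c (startPoint x k n) n ≤ 2 ^ roundingParameter c x m n k :=
      ceilLog_le_iff.mp le_rfl
    have hround := objective_le_two_mul_objective_roundSeq ha hz
      (fun j hj => sum_mul_startPoint_le_one (hcard j hj) (hax j hj)) ((div_le_iff₀ hpos).mp hs)
    rw [greedyRounding]
    linarith

end Guarantee

end GreedyRounding

/-! ### Comparison with the error bound -/

section ErrorBound

open Real

theorem add_one_mul_log_le {u : ℝ} {s N : ℕ} (hu : 1 < u) (hs : s ≤ 6 * u)
    (hN : (s + 1) ^ N < 8 ^ s) : (N + 1) * log u ≤ 26 * u := by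
  have half_log : log √u = log u / 2 := log_sqrt (by linarith)
  rcases le_or_gt √u (s + 1) with hsqrt | hsqrt
  · have log_le : log √u ≤ log (s + 1) := log_le_log (by positivity) hsqrt
    have hNlog : N * log (s + 1) ≤ s * log 8 := by
      rw [← log_pow, ← log_pow]
      exact log_le_log (by positivity) (by exact_mod_cast hN.le)
    have log_eight : log 8 ≤ 2.08 := by
      rw [show (8 : ℝ) = 2 ^ 3 by norm_num, log_pow]
      linarith [log_two_lt_d9]
    have hNu : N * (log u / 2) ≤ N * log (s + 1) :=
      mul_le_mul_of_nonneg_left (half_log ▸ log_le) N.cast_nonneg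
    have hsu : s * log 8 ≤ 6 * u * 2.08 := by gcongr
    linarith [log_le_sub_one_of_pos (by linarith : 0 < u)]
  · have s_pos : s ≠ 0 := by
      rintro rfl
      simp at hN
    have N_lt : N < 3 * s := by
      refine (Nat.pow_lt_pow_iff_right (a := 2) (by norm_num)).mp ?_
      calc 2 ^ N ≤ (s + 1) ^ N := Nat.pow_le_pow_left (by omega) N
        _ < 8 ^ s := hN
        _ = 2 ^ (3 * s) := by rw [pow_mul]; norm_num
    have log_le : log u ≤ 2 * √u := by
      linarith [log_le_sub_one_of_pos (sqrt_pos.mpr (by linarith : 0 < u))]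
    calc (N + 1) * log u ≤ 3 * √u * (2 * √u) := by
          have : (N : ℝ) + 1 ≤ 3 * s := by exact_mod_cast N_lt
          gcongr
          · exact (log_pos hu).le
          · linarith
      _ = 6 * √u ^ 2 := by ring
      _ ≤ 26 * u := by rw [sq_sqrt (by linarith)]; linarith

variable {Y L : ℝ}

theorem natCast_le_six_mul_log {s : ℕ} (hL : log 2 ≤ L) (hZ : exp 1 < Y * L + L)
    (hs : 2 ^ s < 8 * Y) : s ≤ 6 * log (Y * L + L) := by
  have hlog : 1 < log (Y * L + L) := (lt_log_iff_exp_lt ((exp_pos 1).trans hZ)).mpr hZ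
  have hY : 8 * Y ≤ 2 ^ 4 * (Y * L + L) := by
    have : 0 < Y := by linarith [pow_pos (two_pos (α := ℝ)) s]
    nlinarith [log_two_gt_d9]
  have hlogs : s * log 2 ≤ 4 * log 2 + log (Y * L + L) := by
    rw [← log_pow]
    calc log (2 ^ s) ≤ log (2 ^ 4 * (Y * L + L)) :=
          log_le_log (by positivity) (hs.le.trans hY)
      _ = 4 * log 2 + log (Y * L + L) := by
          rw [log_mul (by norm_num) ((exp_pos 1).trans hZ).ne', log_pow]
          norm_num
  nlinarith [log_two_gt_d9, log_two_lt_d9]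

theorem le_mul_sq_of_exp_one_lt (hY : 1 / 4 ≤ Y) (hL : log 2 ≤ L) (hZ : exp 1 < Y * L + L) :
    1.18 ≤ Y * L ^ 2 := by
  have := log_two_gt_d9
  have := exp_one_gt_d9
  rcases le_total Y 4 with hY4 | hY4
  · have hconv : (1 + Y) ^ 2 ≤ 25 / 4 * Y := by nlinarith
    have hsq : 2.7182818283 ^ 2 ≤ (Y * L + L) ^ 2 := by gcongr; linarith
    nlinarith [sq_nonneg L]
  · have hsq : 0.6931471803 ^ 2 ≤ L ^ 2 := by gcongr; linarith
    nlinarith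

theorem log_add_le_mul_log_mul_sq (hY : 1 / 4 ≤ Y) (hL : log 2 ≤ L)
    (hZ : exp 1 < Y * L + L) : log (Y * L + L) ≤ 15 * log (Y * L ^ 2) := by
  have hV : 1.18 ≤ Y * L ^ 2 := le_mul_sq_of_exp_one_lt hY hL hZ
  have hlogV : 0.15 ≤ log (Y * L ^ 2) := by
    refine le_trans ?_ (one_sub_inv_le_log_of_pos (by linarith))
    have : (Y * L ^ 2)⁻¹ ≤ 1.18⁻¹ := by gcongr
    linarith
  have hZV : Y * L + L ≤ exp 2 * (Y * L ^ 2) := by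
    have hexp : 7.3 ≤ exp 2 := by
      rw [show (2 : ℝ) = 1 + 1 by norm_num, exp_add]
      nlinarith [exp_one_gt_d9]
    have hLpos : 0.69 ≤ L := by linarith [log_two_gt_d9]
    calc Y * L + L ≤ 5 * (Y * L) := by nlinarith
      _ ≤ 7.3 * (L * (Y * L)) := by
          nlinarith [mul_nonneg (by linarith : 0 ≤ Y) (by linarith : 0 ≤ L)]
      _ ≤ exp 2 * (Y * L ^ 2) := by nlinarith
  have hlog : log (Y * L + L) ≤ 2 + log (Y * L ^ 2) := by
    rw [← log_exp 2, ← log_mul (exp_pos 2).ne' (by linarith)]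
    exact log_le_log ((exp_pos 1).trans hZ) hZV
  linarith

theorem log_two_le_log_of_exp_one_lt {m n k : ℕ} {p : ℝ}
    (hload : exp 1 < load m n k p + log m) : log 2 ≤ log m := by
  have hm : 2 ≤ m := by
    by_contra! hm
    have hlog : log m = 0 := by interval_cases m <;> simp
    rw [load, hlog] at hload
    simp only [mul_zero, zero_div, add_zero] at hload
    exact hload.not_gt (exp_pos 1)
  exact log_le_log two_pos (by exact_mod_cast hm)

theorem add_one_le_mul_errorBound {m n k s N : ℕ} {p : ℝ}
    (hload : exp 1 < load m n k p + log m) (hs : 2 ^ s < 8 * (m * k * p / n))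
    (hN : (s + 1) ^ N < 8 ^ s) : N + 1 ≤ 400 * errorBound m n k p := by
  set L := log m
  set Y := m * k * p / n
  have hL : log 2 ≤ L := log_two_le_log_of_exp_one_lt hload
  have load_eq : load m n k p = Y * L := by simp only [load, Y, L]; ring
  rw [load_eq] at hload
  have s_pos : s ≠ 0 := by
    rintro rfl
    simp at hN
  have hY : 1 / 4 ≤ Y := by
    have : (2 : ℝ) ≤ 2 ^ s := le_self_pow₀ one_le_two s_pos
    linarith
  have hu : 1 < log (Y * L + L) := (lt_log_iff_exp_lt ((exp_pos 1).trans hload)).mpr hload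
  have numerator_eq : log (Y * L) + log L = log (Y * L ^ 2) := by
    have hL' : L ≠ 0 := ((log_pos one_lt_two).trans_le hL).ne'
    rw [← log_mul (mul_ne_zero (by linarith) hL') hL', mul_assoc, sq]
  have bound := add_one_mul_log_le hu (natCast_le_six_mul_log hL hload hs) hN
  have compare := log_add_le_mul_log_mul_sq hY hL hload
  have quotient_le :
      log (Y * L ^ 2) / log (log (Y * L + L)) ≤ errorBound m n k p := by
    rw [errorBound, load_eq, numerator_eq]
    exact le_max_right _ _
  calc (N + 1 : ℝ) ≤ 400 * (log (Y * L ^ 2) / log (log (Y * L + L))) := by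
        rw [← mul_div_assoc, le_div_iff₀ (log_pos hu)]
        linarith
    _ ≤ 400 * errorBound m n k p := by gcongr

end ErrorBound

section Guarantee

open Finset

theorem greedyRounding_eq_zero_or_one {K : Type*} [Field K] [LinearOrder K] [FloorSemiring K]
    (a : ℕ → ℕ → K) (c x : ℕ → K) (m k : ℕ) {n l : ℕ} (hl : l < n) :
    greedyRounding a c x m n k l = 0 ∨ greedyRounding a c x m n k l = 1 :=
  roundSeq_eq_zero_or_one a c m n _ _ hl

theorem sum_mul_eq_card_filter {K : Type*} [Semiring K] [Nontrivial K] [DecidableEq K]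
    {r y : ℕ → K} {n : ℕ} (hr : ∀ l < n, r l = 0 ∨ r l = 1) (hy : ∀ l < n, y l = 0 ∨ y l = 1) :
    ∑ l ∈ range n, r l * y l = #{l ∈ range n | r l = 1 ∧ y l = 1} := by
  rw [card_filter, Nat.cast_sum]
  refine sum_congr rfl fun l hl => ?_
  rcases hr l (mem_range.mp hl) with hr | hr <;> rcases hy l (mem_range.mp hl) with hy | hy <;>
    simp [hr, hy]

section Coefficients

variable {K : Type*} [Field K] {m n : ℕ} {A : BoolMat m n} {a : ℕ → ℕ → K}

theorem map_objective (f : K →+* ℝ) (c z : ℕ → K) :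
    f (objective c z n) = (fun j : Fin n => f (c j)) ⬝ᵥ fun j : Fin n => f (z j) := by
  simp [objective, dotProduct, sum_range]

variable (ha : ∀ (i : Fin m) (j : Fin n), a i j = if A i j then 1 else 0)
include ha

theorem map_sum_row (f : K →+* ℝ) (z : ℕ → K) (i : Fin m) :
    f (∑ l ∈ range n, a i l * z l) = (A.toReal *ᵥ fun j : Fin n => f (z j)) i := by
  simp [BoolMat.toReal, mulVec, dotProduct, sum_range, ha, apply_ite f]

theorem entry_eq_zero_or_one {j l : ℕ} (hj : j < m) (hl : l < n) : a j l = 0 ∨ a j l = 1 := by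
  rw [ha ⟨j, hj⟩ ⟨l, hl⟩]
  exact (ite_eq_or_eq _ _ _).symm

theorem entry_nonneg [LinearOrder K] [IsStrictOrderedRing K] : ∀ j < m, ∀ l < n, 0 ≤ a j l := by
  intro j hj l hl
  rcases entry_eq_zero_or_one ha hj hl with h | h <;> simp [h]

theorem sum_row_eq_card (i : Fin m) : ∑ l ∈ range n, a i l = #{j | A i j = true} := by
  simp [sum_range, ha]

end Coefficients

variable {K : Type*} [Field K] [LinearOrder K] [IsStrictOrderedRing K] [FloorSemiring K]
  {f : K →+* ℝ} {m n k : ℕ} {p : ℝ} {A : BoolMat m n} {a : ℕ → ℕ → K} {c x : ℕ → K}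

theorem div_le_map_objective_startPoint (hf : StrictMono f) (hc : ∀ l < n, 1 / p ≤ f (c l))
    (hcx : 0 ≤ objective c x n) :
    n / (2 * k * p) ≤ f (objective c (startPoint x k n) n) := by
  have hhalf : 0 ≤ f (objective c x n / 2) :=
    f.map_zero ▸ hf.monotone (div_nonneg hcx zero_le_two)
  calc n / (2 * k * p) = (∑ l ∈ range n, 1 / p) / (2 * k) := by
        rw [sum_const, card_range, nsmul_eq_mul]
        ring
    _ ≤ (∑ l ∈ range n, f (c l)) / (2 * k) := by
        gcongr with l hl
        exact hc l (mem_range.mp hl)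
    _ = f ((∑ l ∈ range n, c l) / (2 * k)) := by simp [map_ofNat]
    _ ≤ f (objective c x n / 2) + f ((∑ l ∈ range n, c l) / (2 * k)) :=
        le_add_of_nonneg_left hhalf
    _ = f (objective c (startPoint x k n) n) := by
        rw [← map_add]
        simp only [objective, sum_mul_startPoint]

theorem two_pow_roundingParameter_lt (hf : StrictMono f) (hk : 1 ≤ k) (hn : 0 < n) (hp : 0 < p)
    (hc : ∀ l < n, 1 / p ≤ f (c l)) (hcx : 0 ≤ objective c x n)
    (hs : roundingParameter c x m n k ≠ 0) :
    2 ^ roundingParameter c x m n k < 8 * (m * k * p / n) := by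
  have hlt : 2 ^ roundingParameter c x m n k * f (objective c (startPoint x k n) n) < 4 * m := by
    simpa [map_ofNat] using hf (two_pow_roundingParameter_mul_objective_lt hs)
  have hle : 2 ^ roundingParameter c x m n k * (n / (2 * k * p)) < 4 * m :=
    lt_of_le_of_lt (by gcongr; exact div_le_map_objective_startPoint hf hc hcx) hlt
  rw [← mul_div_assoc, div_lt_iff₀ (by positivity)] at hle
  rw [← mul_div_assoc, lt_div_iff₀ (by positivity)]
  linarith

section Feasible

variable (hf : StrictMono f) (hp : 0 < p)
  (hcx : Feasible A p (fun j => f (c j)) (fun j => f (x j)))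
include hf hcx

omit [FloorSemiring K] [IsStrictOrderedRing K] in
theorem Feasible.point_mem_Icc : ∀ l < n, x l ∈ Set.Icc 0 1 := by
  intro l hl
  obtain ⟨hzero, hone⟩ := hcx.2.1 ⟨l, hl⟩
  exact ⟨hf.le_iff_le.mp (by simpa using hzero), hf.le_iff_le.mp (by simpa using hone)⟩

include hp in
omit [FloorSemiring K] [IsStrictOrderedRing K] in
theorem Feasible.weight_mem_Icc : ∀ l < n, c l ∈ Set.Icc 0 1 := by
  intro l hl
  obtain ⟨hlow, hone⟩ := hcx.1 ⟨l, hl⟩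
  have hzero : 0 ≤ f (c l) := (one_div_pos.mpr hp).le.trans hlow
  exact ⟨hf.le_iff_le.mp (by simpa using hzero), hf.le_iff_le.mp (by simpa using hone)⟩

variable (hk : 1 ≤ k) (hload : Real.exp 1 < load m n k p + Real.log m)
  (ha : ∀ (i : Fin m) (j : Fin n), a i j = if A i j then 1 else 0)
include hp hk hload ha

theorem mulVec_greedyRounding_le (i : Fin m) :
    (A.toReal *ᵥ fun j : Fin n => f (greedyRounding a c x m n k j)) i ≤
      400 * errorBound m n k p := by
  have hc := hcx.weight_mem_Icc hf hp
  have hx := hcx.point_mem_Icc hf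
  set y := greedyRounding a c x m n k
  have row_eq_card :
      (A.toReal *ᵥ fun j : Fin n => f (y j)) i = #{l ∈ range n | a i l = 1 ∧ y l = 1} := by
    rw [← map_sum_row ha f y i, ← map_natCast f, sum_mul_eq_card_filter
      (fun l hl => entry_eq_zero_or_one ha i.2 hl)
      (fun l hl => greedyRounding_eq_zero_or_one a c x m k hl)]
  rw [row_eq_card]
  rcases hN : #{l ∈ range n | a i l = 1 ∧ y l = 1} with _ | N
  · rw [Nat.cast_zero]
    exact mul_nonneg (by norm_num) (le_max_left _ _)
  have hpow := pow_lt_of_card_rounded_row (entry_nonneg ha)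
    (fun l hl => (startPoint_mem_Icc hk (hx l hl)).1) (fun l hl => (hc l hl).2) i.2 hN
  have hn : 0 < n := by
    obtain ⟨l, hl⟩ := card_pos.mp (N.succ_pos.trans_eq hN.symm)
    exact (Nat.zero_le l).trans_lt (mem_range.mp (mem_filter.mp hl).1)
  have hs : roundingParameter c x m n k ≠ 0 := fun hs => by simp [hs] at hpow
  have hcx_nonneg : 0 ≤ objective c x n := sum_nonneg fun l hl =>
    mul_nonneg (hc l (mem_range.mp hl)).1 (hx l (mem_range.mp hl)).1
  have hlarge := two_pow_roundingParameter_lt hf hk hn hp (fun l hl => (hcx.1 ⟨l, hl⟩).1)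
    hcx_nonneg hs
  exact_mod_cast add_one_le_mul_errorBound hload hlarge hpow

theorem isGoodRounding_greedyRounding (hA : ∀ i, #{j | A i j = true} ≤ k) :
    IsGoodRounding A (400 * errorBound m n k p) (1 / 4) (fun j => f (c j)) (fun j => f (x j))
      (fun j => f (greedyRounding a c x m n k j)) := by
  have hx := hcx.point_mem_Icc hf
  have binary : ∀ j : Fin n, f (greedyRounding a c x m n k j) = 0 ∨
      f (greedyRounding a c x m n k j) = 1 := fun j => by
    rcases greedyRounding_eq_zero_or_one a c x m k j.2 with h | h <;> simp [h]
  refine ⟨binary, ?_, ?_⟩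
  · refine (pi_norm_le_iff_of_nonneg (mul_nonneg (by norm_num) (le_max_left _ _))).mpr fun i => ?_
    rw [Real.norm_of_nonneg]
    · exact mulVec_greedyRounding_le hf hp hcx hk hload ha i
    · rw [← map_sum_row ha f _ i, ← map_zero f]
      refine hf.monotone (sum_nonneg fun l hl => mul_nonneg (entry_nonneg ha i i.2 l ?_) ?_)
      · exact mem_range.mp hl
      · rcases greedyRounding_eq_zero_or_one a c x m k (mem_range.mp hl) with h | h <;> simp [h]
  · have hax : ∀ j < m, ∑ l ∈ range n, a j l * x l ≤ 1 := fun j hj =>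
      hf.le_iff_le.mp (by simpa [map_sum_row ha f x ⟨j, hj⟩] using hcx.2.2 ⟨j, hj⟩)
    have hobj := hf.monotone (objective_le_four_mul_objective_greedyRounding hk (entry_nonneg ha)
      (fun j hj => (sum_row_eq_card ha ⟨j, hj⟩).trans_le (by exact_mod_cast hA ⟨j, hj⟩))
      (fun l hl => (hcx.weight_mem_Icc hf hp l hl).1) hx hax)
    rw [map_mul, map_ofNat, map_objective, map_objective] at hobj
    linarith

end Feasible

end Guarantee

/-! ### Heights of rational numbers -/

/-- `q` has absolute value and denominator at most `2 ^ h`. Unlike `bitLength`, such bounds simply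
add up under sums and products. -/
structure HtLe (q : ℚ) (h : ℕ) : Prop where
  one_le : 1 ≤ h
  abs_le : |q| ≤ 2 ^ h
  den_le : q.den ≤ 2 ^ h

theorem natAbs_num_eq_abs_mul_den (q : ℚ) : (q.num.natAbs : ℚ) = |q| * q.den := by
  rw [Nat.cast_natAbs, Int.cast_abs, ← Rat.mul_den_eq_num, abs_mul, Nat.abs_cast]

namespace HtLe

variable {q r : ℚ} {g h : ℕ}

theorem mono (hq : HtLe q g) (hgh : g ≤ h) : HtLe q h where
  one_le := hq.one_le.trans hgh
  abs_le := hq.abs_le.trans (pow_le_pow_right₀ one_le_two hgh)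
  den_le := hq.den_le.trans (Nat.pow_le_pow_right two_pos hgh)

theorem neg (hq : HtLe q h) : HtLe (-q) h where
  one_le := hq.one_le
  abs_le := by simpa using hq.abs_le
  den_le := by simpa using hq.den_le

theorem add (hq : HtLe q g) (hr : HtLe r h) : HtLe (q + r) (g + h) where
  one_le := le_add_right hq.one_le
  abs_le := by
    have two_le_pow {d : ℕ} (hd : 1 ≤ d) : (2 : ℚ) ≤ 2 ^ d := le_self_pow₀ one_le_two (by omega)
    calc |q + r| ≤ |q| + |r| := abs_add_le q r
      _ ≤ 2 ^ g + 2 ^ h := add_le_add hq.abs_le hr.abs_le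
      _ ≤ 2 ^ g * 2 ^ h := add_le_mul (two_le_pow hq.one_le) (two_le_pow hr.one_le)
      _ = 2 ^ (g + h) := (pow_add _ _ _).symm
  den_le := by
    rw [pow_add]
    exact (Nat.le_of_dvd (Nat.mul_pos q.den_pos r.den_pos) (Rat.add_den_dvd q r)).trans
      (Nat.mul_le_mul hq.den_le hr.den_le)

theorem sub (hq : HtLe q g) (hr : HtLe r h) : HtLe (q - r) (g + h) := by
  simpa only [sub_eq_add_neg] using hq.add hr.neg

theorem mul (hq : HtLe q g) (hr : HtLe r h) : HtLe (q * r) (g + h) where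
  one_le := le_add_right hq.one_le
  abs_le := by
    rw [pow_add, abs_mul]
    exact mul_le_mul hq.abs_le hr.abs_le (abs_nonneg _) (by positivity)
  den_le := by
    rw [pow_add]
    exact (Nat.le_of_dvd (Nat.mul_pos q.den_pos r.den_pos) (Rat.mul_den_dvd q r)).trans
      (Nat.mul_le_mul hq.den_le hr.den_le)

theorem natCast {n : ℕ} (hh : 1 ≤ h) (hn : n ≤ 2 ^ h) : HtLe n h where
  one_le := hh
  abs_le := by
    rw [Nat.abs_cast]
    exact_mod_cast hn
  den_le := by simpa using Nat.one_le_two_pow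

theorem zero (hh : 1 ≤ h) : HtLe 0 h := by
  simpa using natCast (n := 0) hh (Nat.zero_le _)

theorem one (hh : 1 ≤ h) : HtLe 1 h := by
  simpa using natCast (n := 1) hh Nat.one_le_two_pow

theorem num_le (hq : HtLe q h) : q.num.natAbs ≤ 2 ^ (2 * h) := by
  have hden : (q.den : ℚ) ≤ 2 ^ h := by exact_mod_cast hq.den_le
  have hnum : (q.num.natAbs : ℚ) ≤ 2 ^ (2 * h) :=
    calc (q.num.natAbs : ℚ) = |q| * q.den := natAbs_num_eq_abs_mul_den q
      _ ≤ 2 ^ h * 2 ^ h := mul_le_mul hq.abs_le hden (by positivity) (by positivity)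
      _ = 2 ^ (2 * h) := by rw [two_mul, pow_add]
  exact_mod_cast hnum

theorem inv (hq : HtLe q h) : HtLe q⁻¹ (2 * h) := by
  have two_mul_pos : 1 ≤ 2 * h := by linarith [hq.one_le]
  rcases eq_or_ne q 0 with rfl | hq0
  · simpa using zero two_mul_pos
  refine ⟨two_mul_pos, ?_, (Rat.den_inv_of_ne_zero hq0).trans_le hq.num_le⟩
  have one_le_natAbs_num : (1 : ℚ) ≤ q.num.natAbs := by
    exact_mod_cast Int.natAbs_pos.mpr (Rat.num_ne_zero.mpr hq0)
  calc |q⁻¹| ≤ q.den := by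
        rw [abs_inv, inv_le_iff_one_le_mul₀ (abs_pos.mpr hq0), mul_comm]
        exact one_le_natAbs_num.trans_eq (natAbs_num_eq_abs_mul_den q)
    _ ≤ 2 ^ h := by exact_mod_cast hq.den_le
    _ ≤ 2 ^ (2 * h) := pow_le_pow_right₀ one_le_two (by omega)

theorem div (hq : HtLe q g) (hr : HtLe r h) : HtLe (q / r) (g + 2 * h) := by
  simpa only [div_eq_mul_inv] using hq.mul hr.inv

theorem ite_one_zero {p : Prop} [Decidable p] (hh : 1 ≤ h) : HtLe (if p then 1 else 0) h := by
  split_ifs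
  exacts [one hh, zero hh]

theorem sum_range {f : ℕ → ℚ} {n : ℕ} (hng : n < g) (hf : ∀ i < n, HtLe (f i) h) (hh : 1 ≤ h) :
    HtLe (∑ i ∈ Finset.range n, f i) (g * h) := by
  induction n generalizing g with
  | zero => simpa using zero (Nat.mul_pos hng hh)
  | succ n ih =>
    rw [Finset.sum_range_succ]
    refine ((ih n.lt_succ_self fun i hi => hf i (by omega)).add (hf n (by omega))).mono ?_
    rw [← add_one_mul]
    gcongr
    omega

theorem prod_range {f : ℕ → ℚ} {n : ℕ} (hng : n < g) (hf : ∀ i < n, HtLe (f i) h) (hh : 1 ≤ h) :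
    HtLe (∏ i ∈ Finset.range n, f i) (g * h) := by
  induction n generalizing g with
  | zero => simpa using one (Nat.mul_pos hng hh)
  | succ n ih =>
    rw [Finset.prod_range_succ]
    refine ((ih n.lt_succ_self fun i hi => hf i (by omega)).mul (hf n (by omega))).mono ?_
    rw [← add_one_mul]
    gcongr
    omega

theorem of_bitLength_le (hq : bitLength q ≤ h) : HtLe q h := by
  unfold bitLength at hq
  have hnum : q.num.natAbs ≤ 2 ^ h :=
    (Nat.lt_size_self _).le.trans (Nat.pow_le_pow_right two_pos (by omega))
  have hden : q.den ≤ 2 ^ h :=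
    (Nat.lt_size_self _).le.trans (Nat.pow_le_pow_right two_pos (by omega))
  refine ⟨by omega, ?_, hden⟩
  calc |q| ≤ |q| * q.den :=
        le_mul_of_one_le_right (abs_nonneg q) (by exact_mod_cast q.den_pos)
    _ = q.num.natAbs := (natAbs_num_eq_abs_mul_den q).symm
    _ ≤ 2 ^ h := by exact_mod_cast hnum

theorem bitLength_le (hq : HtLe q h) : bitLength q ≤ 6 * h := by
  have hnum : Nat.size q.num.natAbs ≤ 2 * h + 1 :=
    Nat.size_le.mpr (hq.num_le.trans_lt (Nat.pow_lt_pow_right one_lt_two (by omega)))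
  have hden : Nat.size q.den ≤ h + 1 :=
    Nat.size_le.mpr (hq.den_le.trans_lt (Nat.pow_lt_pow_right one_lt_two (by omega)))
  have := hq.one_le
  unfold bitLength
  omega

end HtLe

/-! ### Running times of programs with bounded memory contents -/

/-- The factor by which an expression enlarges heights: if all memory cells have height at most
`h`, then its value has height at most `e.htFactor * h`. -/
def Expr.htFactor : Expr → ℕ
  | .const q => bitLength q
  | .get _ _ => 1
  | .add e f => e.htFactor + f.htFactor
  | .sub e f => e.htFactor + f.htFactor
  | .mul e f => e.htFactor + f.htFactor
  | .div e f => e.htFactor + 2 * f.htFactor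
  | .lt _ _ => 1

/-- The cost of an expression relative to heights: if all memory cells have height at most `h`,
then it is evaluated at cost at most `e.costFactor * h`. -/
def Expr.costFactor : Expr → ℕ
  | .const q => 6 * bitLength q
  | .get _ i => i.costFactor + 6
  | .add e f => e.costFactor + f.costFactor + 6 * (e.htFactor + f.htFactor)
  | .sub e f => e.costFactor + f.costFactor + 6 * (e.htFactor + f.htFactor)
  | .mul e f => e.costFactor + f.costFactor + 6 * (e.htFactor + f.htFactor)
  | .div e f => e.costFactor + f.costFactor + 6 * (e.htFactor + 2 * f.htFactor)
  | .lt e f => e.costFactor + f.costFactor + 6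

theorem Expr.htLe_eval {M : Memory} {h : ℕ} (hM : ∀ a l, HtLe (M a l) h) (e : Expr) :
    HtLe (e.eval M) (e.htFactor * h) := by
  have hh : 1 ≤ h := (hM 0 0).one_le
  induction e with
  | const q => exact (HtLe.of_bitLength_le le_rfl).mono (Nat.le_mul_of_pos_right _ hh)
  | get a i => simpa only [Expr.htFactor, Expr.eval, one_mul] using hM a _
  | add e f he hf => simpa only [Expr.htFactor, Expr.eval, add_mul] using he.add hf
  | sub e f he hf => simpa only [Expr.htFactor, Expr.eval, add_mul] using he.sub hf
  | mul e f he hf => simpa only [Expr.htFactor, Expr.eval, add_mul] using he.mul hf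
  | div e f he hf => simpa only [Expr.htFactor, Expr.eval, add_mul, mul_assoc] using he.div hf
  | lt e f => exact HtLe.ite_one_zero (by simpa only [Expr.htFactor, one_mul] using hh)

theorem Expr.cost_le {M : Memory} {h : ℕ} (hM : ∀ a l, HtLe (M a l) h) (e : Expr) :
    e.cost M ≤ e.costFactor * h := by
  have bitLength_eval_le (e : Expr) : bitLength (e.eval M) ≤ 6 * (e.htFactor * h) :=
    (htLe_eval hM e).bitLength_le
  induction e with
  | const q =>
    have hh : 1 ≤ h := (hM 0 0).one_le
    exact (Nat.le_mul_of_pos_left _ (by norm_num)).trans (Nat.le_mul_of_pos_right _ hh)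
  | _ =>
    refine (add_le_add (by first | assumption | exact add_le_add ‹_› ‹_›)
      (bitLength_eval_le _)).trans_eq ?_
    simp only [Expr.costFactor, Expr.htFactor]
    ring

/-- The total size of the code, expressions being weighted by their cost factors. -/
def Prog.weight : Prog → ℕ
  | .skip => 1
  | .assign _ i e => i.costFactor + e.costFactor + 1
  | .toss _ i => i.costFactor + 1
  | .seq P Q => P.weight + Q.weight + 1
  | .ite b P Q => b.costFactor + P.weight + Q.weight + 1
  | .while b P => b.costFactor + P.weight + 1

/-- The nesting depth of the loops. -/
def Prog.depth : Prog → ℕ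
  | .skip => 0
  | .assign _ _ _ => 0
  | .toss _ _ => 0
  | .seq P Q => max P.depth Q.depth
  | .ite _ P Q => max P.depth Q.depth
  | .while _ P => P.depth + 1

/-- Total correctness with a time bound: from each memory with `pre`, the program `P` reaches a
memory with `post` without tossing coins, in the time that suffices if the memory contents have
height at most `h` and each loop has at most `R` passes. -/
def HoareTriple (h R : ℕ) (pre : Memory → Prop) (P : Prog) (post : Memory → Prop) : Prop :=
  ∀ M, pre M → ∀ (ω : ℕ → Bool) (u : ℕ), ∃ (t : ℕ) (M' : Memory),
    Run ω P ⟨M, u⟩ t ⟨M', u⟩ ∧ t ≤ P.weight * ((h + 1) * (R + 1) ^ P.depth) ∧ post M'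

namespace HoareTriple

variable {h R : ℕ} {P Q : Prog} {pre mid post : Memory → Prop}

theorem weaken {post' : Memory → Prop} (hP : HoareTriple h R pre P post)
    (hpost : ∀ M, post M → post' M) : HoareTriple h R pre P post' := by
  intro M hM ω u
  obtain ⟨t, M', hrun, ht, hM'⟩ := hP M hM ω u
  exact ⟨t, M', hrun, ht, hpost M' hM'⟩

theorem assign {a : ℕ} {i e : Expr} (hpre : ∀ M, pre M → ∀ a l, HtLe (M a l) h)
    (hpost : ∀ M, pre M → post (M.write a ⌊i.eval M⌋₊ (e.eval M))) :
    HoareTriple h R pre (.assign a i e) post := by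
  intro M hM ω u
  refine ⟨_, _, Run.assign a i e ⟨M, u⟩, ?_, hpost M hM⟩
  calc i.cost M + e.cost M + 1 ≤ i.costFactor * h + e.costFactor * h + (h + 1) :=
        add_le_add (add_le_add (i.cost_le (hpre M hM)) (e.cost_le (hpre M hM))) (by omega)
    _ ≤ (i.costFactor + e.costFactor + 1) * ((h + 1) * (R + 1) ^ 0) := by
        rw [pow_zero]
        linarith

theorem seq (hP : HoareTriple h R pre P mid) (hQ : HoareTriple h R mid Q post) :
    HoareTriple h R pre (.seq P Q) post := by
  intro M hM ω u
  obtain ⟨t₁, M₁, hrun₁, ht₁, hmid⟩ := hP M hM ω u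
  obtain ⟨t₂, M₂, hrun₂, ht₂, hpost⟩ := hQ M₁ hmid ω u
  refine ⟨_, M₂, Run.seq hrun₁ hrun₂, ?_, hpost⟩
  calc t₁ + t₂ + 1
      ≤ P.weight * ((h + 1) * (R + 1) ^ P.depth) + Q.weight * ((h + 1) * (R + 1) ^ Q.depth) + 1 :=
        by gcongr
    _ ≤ P.weight * ((h + 1) * (R + 1) ^ max P.depth Q.depth) +
        Q.weight * ((h + 1) * (R + 1) ^ max P.depth Q.depth) +
        (h + 1) * (R + 1) ^ max P.depth Q.depth := by
        gcongr
        · omega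
        · exact le_max_left _ _
        · omega
        · exact le_max_right _ _
        · exact Nat.mul_pos h.succ_pos (Nat.pow_pos R.succ_pos)
    _ = (Prog.seq P Q).weight * ((h + 1) * (R + 1) ^ (Prog.seq P Q).depth) := by
        simp only [Prog.weight, Prog.depth]
        ring

theorem loop_add {b : Expr} {N : ℕ} {inv : ℕ → Memory → Prop}
    (hht : ∀ i M, inv i M → ∀ a l, HtLe (M a l) h)
    (htest : ∀ i M, inv i M → (b.eval M = 0 ↔ N ≤ i))
    (hbody : ∀ i < N, HoareTriple h R (inv i) P (inv (i + 1))) {d i : ℕ} (hdi : i + d = N)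
    {M : Memory} (hM : inv i M) (ω : ℕ → Bool) (u : ℕ) :
    ∃ (t : ℕ) (M' : Memory), Run ω (.while b P) ⟨M, u⟩ t ⟨M', u⟩ ∧
      t ≤ (d + 1) * (b.costFactor * h + P.weight * ((h + 1) * (R + 1) ^ P.depth) + 1) ∧
      inv N M' := by
  have hcost := b.cost_le (hht i M hM)
  induction d generalizing i M with
  | zero =>
    obtain rfl : i = N := by omega
    refine ⟨_, M, Run.while_done ((htest i M hM).mpr le_rfl), ?_, hM⟩
    dsimp only
    linarith [Nat.zero_le (P.weight * ((h + 1) * (R + 1) ^ P.depth))]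
  | succ d ih =>
    have hb : b.eval M ≠ 0 := mt (htest i M hM).mp (by omega)
    obtain ⟨t₁, M₁, hrun₁, ht₁, hM₁⟩ := hbody i (by omega) M hM ω u
    obtain ⟨t₂, M₂, hrun₂, ht₂, hM₂⟩ := ih (by omega) hM₁ (b.cost_le (hht _ M₁ hM₁))
    refine ⟨_, M₂, Run.while_step hb hrun₁ hrun₂, ?_, hM₂⟩
    dsimp only
    linarith

theorem loop {b : Expr} {N : ℕ} {inv : ℕ → Memory → Prop} (hNR : N ≤ R)
    (hht : ∀ i M, inv i M → ∀ a l, HtLe (M a l) h)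
    (htest : ∀ i M, inv i M → (b.eval M = 0 ↔ N ≤ i))
    (hbody : ∀ i < N, HoareTriple h R (inv i) P (inv (i + 1))) :
    HoareTriple h R (inv 0) (.while b P) (inv N) := by
  intro M hM ω u
  obtain ⟨t, M', hrun, ht, hM'⟩ := loop_add hht htest hbody (zero_add N) hM ω u
  refine ⟨t, M', hrun, ht.trans ?_, hM'⟩
  have hpow : 1 ≤ (R + 1) ^ P.depth := Nat.pow_pos R.succ_pos
  calc (N + 1) * (b.costFactor * h + P.weight * ((h + 1) * (R + 1) ^ P.depth) + 1)
      ≤ (R + 1) * (b.costFactor * ((h + 1) * (R + 1) ^ P.depth) +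
        P.weight * ((h + 1) * (R + 1) ^ P.depth) + (h + 1) * (R + 1) ^ P.depth) := by
        gcongr
        · exact h.le_succ.trans (Nat.le_mul_of_pos_right _ hpow)
        · exact Nat.mul_pos h.succ_pos hpow
    _ = (Prog.while b P).weight * ((h + 1) * (R + 1) ^ (Prog.while b P).depth) := by
        simp only [Prog.weight, Prog.depth]
        ring

end HoareTriple

/-! ### Registers and counting loops -/

namespace Expr

instance : Add Expr := ⟨.add⟩

instance : Mul Expr := ⟨.mul⟩

instance : Div Expr := ⟨.div⟩

instance (n : ℕ) : OfNat Expr n := ⟨.const n⟩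

/-- The register `r`; the registers are the cells of array `5`. -/
def reg (r : ℕ) : Expr := .get 5 (.const r)

/-- The number of rows of the input matrix. -/
def rows : Expr := .get 0 0

/-- The number of columns of the input matrix. -/
def cols : Expr := .get 0 1

/-- The entry of the input matrix whose indices are held by the registers `j` and `l`. -/
def entry (j l : ℕ) : Expr := .get 1 (reg j * cols + reg l)

variable (M : Memory) (e f : Expr)

theorem eval_add : (e + f).eval M = e.eval M + f.eval M := rfl

theorem eval_mul : (e * f).eval M = e.eval M * f.eval M := rfl

theorem eval_div : (e / f).eval M = e.eval M / f.eval M := rfl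

theorem eval_lt : (Expr.lt e f).eval M = if e.eval M < f.eval M then 1 else 0 := rfl

theorem eval_zero : (0 : Expr).eval M = 0 := Nat.cast_zero

theorem eval_one : (1 : Expr).eval M = 1 := Nat.cast_one

theorem eval_two : (2 : Expr).eval M = 2 := Nat.cast_ofNat

end Expr

namespace Prog

/-- Assignment to the register `r`. -/
def setReg (r : ℕ) (e : Expr) : Prog := .assign 5 (.const r) e

/-- Run `P` with the register `r` ranging from `0` to `b - 1`. -/
def forLoop (r : ℕ) (b : Expr) (P : Prog) : Prog :=
  .seq (.setReg r 0) (.while (.lt (.reg r) b) (.seq P (.setReg r (.reg r + 1))))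

end Prog

/-- The memory `M` still holds the input `I` in the arrays `0`, …, `3`, it holds the point `z` in
array `4` and the values `ρ` in the first registers, and its contents have height at most `h`. -/
structure Holds (h : ℕ) (I : Memory) (z : ℕ → ℚ) (ρ : List ℚ) (M : Memory) : Prop where
  input : ∀ a < 4, M a = I a
  point : M 4 = z
  reg : ∀ (r : ℕ) (hr : r < ρ.length), M 5 r = ρ[r]
  htLe : ∀ a l, HtLe (M a l) h

namespace Holds

variable {h : ℕ} {I M : Memory} {z : ℕ → ℚ} {ρ τ : List ℚ}

theorem of_append (hM : Holds h I z (ρ ++ τ) M) : Holds h I z ρ M where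
  input := hM.input
  point := hM.point
  reg r hr := by
    rw [hM.reg r (by simp only [List.length_append]; omega), List.getElem_append_left hr]
  htLe := hM.htLe

theorem eval_reg (hM : Holds h I z ρ M) {r : ℕ} (hr : r < ρ.length) :
    (Expr.reg r).eval M = ρ[r] := by
  rw [← hM.reg r hr]
  simp only [Expr.reg, Expr.eval, Nat.floor_natCast]

theorem eval_get_input (hM : Holds h I z ρ M) {a : ℕ} (ha : a < 4) (e : Expr) :
    (Expr.get a e).eval M = I a ⌊e.eval M⌋₊ := by
  rw [Expr.eval, hM.input a ha]

theorem eval_get_point (hM : Holds h I z ρ M) (e : Expr) :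
    (Expr.get 4 e).eval M = z ⌊e.eval M⌋₊ := by
  rw [Expr.eval, hM.point]

theorem htLe_write (hM : ∀ a l, HtLe (M a l) h) (a i : ℕ) {q : ℚ} (hq : HtLe q h) (a' i' : ℕ) :
    HtLe (M.write a i q a' i') h := by
  unfold Memory.write
  split_ifs
  exacts [hq, hM a' i']

end Holds

namespace HoareTriple

variable {h R : ℕ} {I : Memory} {z : ℕ → ℚ} {ρ τ : List ℚ}

theorem setReg {r : ℕ} {e : Expr} {q : ℚ} (hr : r ≤ ρ.length)
    (hτ : ρ.take r ++ q :: ρ.drop (r + 1) = τ) (hq : HtLe q h)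
    (he : ∀ M, Holds h I z ρ M → e.eval M = q) :
    HoareTriple h R (Holds h I z ρ) (.setReg r e) (Holds h I z τ) := by
  subst hτ
  refine assign (fun M hM => hM.htLe) fun M hM => ?_
  simp only [Expr.eval, Nat.floor_natCast, he M hM]
  refine ⟨fun a ha => ?_, ?_, fun l hl => ?_, Holds.htLe_write hM.htLe 5 r hq⟩
  · grind [Memory.write, hM.input a ha]
  · grind [Memory.write, hM.point]
  · grind [Memory.write, hM.reg l]

theorem setPoint {e f : Expr} {i : ℕ} {q : ℚ} (hq : HtLe q h)
    (he : ∀ M, Holds h I z ρ M → e.eval M = i) (hf : ∀ M, Holds h I z ρ M → f.eval M = q) :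
    HoareTriple h R (Holds h I z ρ) (.assign 4 e f)
      (Holds h I (Function.update z i q) ρ) := by
  refine assign (fun M hM => hM.htLe) fun M hM => ?_
  simp only [he M hM, hf M hM, Nat.floor_natCast]
  refine ⟨fun a ha => ?_, ?_, fun l hl => ?_, Holds.htLe_write hM.htLe 4 i hq⟩
  · grind [Memory.write, hM.input a ha]
  · grind [Memory.write, hM.point, Function.update]
  · grind [Memory.write, hM.reg l]

theorem forLoop {Z : ℕ → ℕ → ℚ} {ρ : ℕ → List ℚ} {r N : ℕ} {b : Expr} {P : Prog}
    (hρ : ∀ i, (ρ i).length = r) (hNh : N < h) (hNR : N ≤ R)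
    (hb : ∀ z ρ M, Holds h I z ρ M → b.eval M = N)
    (hP : ∀ i < N, HoareTriple h R (Holds h I (Z i) (ρ i ++ [(i : ℚ)])) P
      (Holds h I (Z (i + 1)) (ρ (i + 1) ++ [(i : ℚ)]))) :
    HoareTriple h R (Holds h I (Z 0) (ρ 0)) (.forLoop r b P) (Holds h I (Z N) (ρ N)) := by
  have counter_htLe {i : ℕ} (hi : i ≤ N) : HtLe i h :=
    .natCast (by omega) (hi.trans (hNh.trans h.lt_two_pow_self).le)
  have counter_eval {i j : ℕ} {z M} (hM : Holds h I z (ρ i ++ [(j : ℚ)]) M) :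
      (Expr.reg r).eval M = j := by
    simp [hM.eval_reg, hρ]
  have init : HoareTriple h R (Holds h I (Z 0) (ρ 0)) (.setReg r 0)
      (Holds h I (Z 0) (ρ 0 ++ [((0 : ℕ) : ℚ)])) :=
    setReg (hρ 0).ge (by simp [← hρ 0]) (counter_htLe N.zero_le) fun M _ => by simp [Expr.eval_zero]
  have step (i : ℕ) (hi : i < N) : HoareTriple h R (Holds h I (Z (i + 1)) (ρ (i + 1) ++ [(i : ℚ)]))
      (.setReg r (.reg r + 1)) (Holds h I (Z (i + 1)) (ρ (i + 1) ++ [((i + 1 : ℕ) : ℚ)])) :=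
    setReg (by simp [hρ]) (by simp [← hρ (i + 1)]) (counter_htLe hi) fun M hM => by
      simp [Expr.eval_add, counter_eval hM, Expr.eval_one]
  have test (i : ℕ) (M : Memory) (hM : Holds h I (Z i) (ρ i ++ [(i : ℚ)]) M) :
      (Expr.lt (.reg r) b).eval M = 0 ↔ N ≤ i := by
    simp [Expr.eval_lt, counter_eval hM, hb _ _ M hM]
  exact (init.seq (.loop hNR (fun i M hM => hM.htLe) test
    fun i hi => (hP i hi).seq (step i hi))).weaken fun M hM => hM.of_append

end HoareTriple

/-! ### The rounding program -/

namespace RoundingProgram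

open Finset Function Expr

/- The registers `0, …, 8` hold `k`, the objective value of the starting point, the parameter `s`,
`2 ^ s`, the column `i` to be rounded, its congestion, a row `j`, its weight and a column `l`. -/

/-- The number of ones in the first row. -/
def countProg : Prog :=
  .seq (.setReg 0 0) (.forLoop 1 cols (.setReg 0 (.reg 0 + .get 1 (.reg 1))))

/-- The starting point and its objective value. -/
def startProg : Prog :=
  .seq (.setReg 1 0) (.forLoop 2 cols (.seq
    (.assign 4 (.reg 2) (.get 3 (.reg 2) / 2 + 1 / (2 * .reg 0)))
    (.setReg 1 (.reg 1 + .get 2 (.reg 2) * .get 4 (.reg 2)))))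

/-- The parameter `s` and the power `2 ^ s`. -/
def exponentProg : Prog :=
  .seq (.setReg 2 0) (.seq (.setReg 3 1) (.while (.lt (.reg 3) (2 * rows / .reg 1))
    (.seq (.setReg 2 (.reg 2 + 1)) (.setReg 3 (2 * .reg 3)))))

/-- The weight of the row `j`. -/
def rowWeightProg : Prog :=
  .seq (.setReg 7 1) (.forLoop 8 cols
    (.setReg 7 (.reg 7 * (1 + .reg 2 * (entry 6 8 * .get 4 (.reg 8))))))

/-- The congestion of the column `i`. -/
def congestionProg : Prog :=
  .seq (.setReg 5 0) (.forLoop 6 rows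
    (.seq rowWeightProg (.setReg 5 (.reg 5 + entry 6 4 * .reg 7))))

/-- The rounding of the coordinates, one after the other. -/
def roundProg : Prog :=
  .forLoop 4 cols (.seq (.assign 4 (.reg 4) 0) (.seq congestionProg
    (.assign 4 (.reg 4) (.lt (.reg 5) (.get 2 (.reg 4) * (.reg 3 * .reg 3 * .reg 3))))))

/-- The rounding algorithm; it is deterministic. -/
def program : Prog := .seq countProg (.seq startProg (.seq exponentProg roundProg))

/-- The memory `I` holds an `m × n` matrix, in row-major order, and two vectors; the first row of
the matrix has the sum `k`, and all entries and dimensions are bounded by means of `b`. -/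
structure IsInput (I : Memory) (m n k b : ℕ) : Prop where
  rows_eq : I 0 0 = m
  cols_eq : I 0 1 = n
  row_sum : ∑ l ∈ range n, I 1 l = k
  htLe : ∀ a l, HtLe (I a l) b
  rows_lt : m < b
  cols_lt : n < b

/-- The matrix stored in the memory `I`. -/
def inputMatrix (I : Memory) (n : ℕ) : ℕ → ℕ → ℚ := fun j l => I 1 (j * n + l)

section

variable {h : ℕ} {I M : Memory} {m n k b : ℕ} {z : ℕ → ℚ} {ρ : List ℚ}

section Height

theorem htLe_startPoint {x : ℕ → ℚ} (hx : ∀ l, HtLe (x l) b) (hk : HtLe k (b ^ 2)) (n l : ℕ) :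
    HtLe (startPoint x k n l) (8 * b ^ 2) := by
  have hb : 1 ≤ b := (hx 0).one_le
  have two : HtLe (2 : ℚ) 1 := by simpa using HtLe.natCast (n := 2) le_rfl (by norm_num)
  have hb2 : b ≤ b ^ 2 := Nat.le_self_pow two_ne_zero b
  rw [startPoint]
  split_ifs
  · refine (((hx l).div two).add ((HtLe.one le_rfl).div (two.mul hk))).mono ?_
    omega
  · exact .zero (by omega)

theorem htLe_objective {c z : ℕ → ℚ} (hc : ∀ l, HtLe (c l) b) (hz : ∀ l, HtLe (z l) (8 * b ^ 2))
    {n : ℕ} (hn : n < b) : HtLe (objective c z n) (9 * b ^ 3) :=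
  (HtLe.sum_range hn (fun l _ => (hc l).mul (hz l)) (by have := (hz 0).one_le; omega)).mono <| by
    nlinarith [Nat.pow_le_pow_right (hc 0).one_le (show 2 ≤ 3 by norm_num)]

theorem htLe_rowWeight {r z : ℕ → ℚ} {s : ℕ} (hr : ∀ l, HtLe (r l) b)
    (hz : ∀ l, HtLe (z l) (8 * b ^ 2)) (hs : HtLe s (20 * b ^ 3)) {n : ℕ} (hn : n < b) :
    HtLe (rowWeight r z s n) (30 * b ^ 4) := by
  have hb : 1 ≤ b := (hr 0).one_le
  refine (HtLe.prod_range hn (fun l _ => (HtLe.one le_rfl).add (hs.mul ((hr l).mul (hz l))))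
    (by omega)).mono ?_
  nlinarith [Nat.pow_le_pow_right hb (show 1 ≤ 4 by norm_num),
    Nat.pow_le_pow_right hb (show 2 ≤ 4 by norm_num),
    Nat.pow_le_pow_right hb (show 3 ≤ 4 by norm_num)]

theorem htLe_congestion {a : ℕ → ℕ → ℚ} {z : ℕ → ℚ} {s : ℕ} (ha : ∀ j l, HtLe (a j l) b)
    (hz : ∀ l, HtLe (z l) (8 * b ^ 2)) (hs : HtLe s (20 * b ^ 3)) {m n : ℕ} (hm : m < b)
    (hn : n < b) (i : ℕ) : HtLe (congestion a z m n s i) (31 * b ^ 5) := by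
  have hb : 1 ≤ b := (ha 0 0).one_le
  refine (HtLe.sum_range hm
    (fun j _ => (ha j i).mul (htLe_rowWeight (ha j) hz hs hn)) (by omega)).mono ?_
  nlinarith [Nat.pow_le_pow_right hb (show 2 ≤ 5 by norm_num)]

end Height

/-- The program `P` takes the point `z` and the register contents `ρ` to `z'` and `ρ'`, on the
input `I`; the bounds for the heights and the numbers of passes are those of the rounding program
on inputs with the bound `b`. -/
abbrev Transforms (I : Memory) (b : ℕ) (z : ℕ → ℚ) (ρ : List ℚ) (P : Prog) (z' : ℕ → ℚ)
    (ρ' : List ℚ) : Prop :=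
  HoareTriple (31 * b ^ 5) (20 * b ^ 3) (Holds (31 * b ^ 5) I z ρ) P (Holds (31 * b ^ 5) I z' ρ')

theorem eval_rows (hI : IsInput I m n k b) (hM : Holds h I z ρ M) : rows.eval M = m := by
  simp [rows, hM.eval_get_input, eval_zero, hI.rows_eq]

theorem eval_cols (hI : IsInput I m n k b) (hM : Holds h I z ρ M) : cols.eval M = n := by
  simp [cols, hM.eval_get_input, eval_one, hI.cols_eq]

theorem eval_entry (hI : IsInput I m n k b) (hM : Holds h I z ρ M) {r t j l : ℕ}
    (hr : r < ρ.length) (ht : t < ρ.length) (hj : ρ[r] = j) (hl : ρ[t] = l) :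
    (entry r t).eval M = inputMatrix I n j l := by
  have hindex : (j * n + l : ℚ) = (j * n + l : ℕ) := by norm_cast
  rw [entry, hM.eval_get_input (by norm_num), eval_add, eval_mul, hM.eval_reg hr, hM.eval_reg ht,
    eval_cols hI hM, hj, hl, hindex, Nat.floor_natCast, inputMatrix]

theorem forLoop_cols (hI : IsInput I m n k b) {Z : ℕ → ℕ → ℚ} {ρ : ℕ → List ℚ} {r : ℕ} {P : Prog}
    (hρ : ∀ i, (ρ i).length = r)
    (hP : ∀ i < n, Transforms I b (Z i) (ρ i ++ [(i : ℚ)]) P (Z (i + 1)) (ρ (i + 1) ++ [(i : ℚ)])) :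
    Transforms I b (Z 0) (ρ 0) (.forLoop r cols P) (Z n) (ρ n) := by
  have hn := hI.cols_lt
  have hb3 : b ≤ b ^ 3 := Nat.le_self_pow (by norm_num) b
  have hb5 : b ≤ b ^ 5 := Nat.le_self_pow (by norm_num) b
  exact .forLoop hρ (by omega) (by omega) (fun _ _ _ hM => eval_cols hI hM) hP

theorem forLoop_rows (hI : IsInput I m n k b) {Z : ℕ → ℕ → ℚ} {ρ : ℕ → List ℚ} {r : ℕ} {P : Prog}
    (hρ : ∀ i, (ρ i).length = r)
    (hP : ∀ i < m, Transforms I b (Z i) (ρ i ++ [(i : ℚ)]) P (Z (i + 1)) (ρ (i + 1) ++ [(i : ℚ)])) :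
    Transforms I b (Z 0) (ρ 0) (.forLoop r rows P) (Z m) (ρ m) := by
  have hm := hI.rows_lt
  have hb3 : b ≤ b ^ 3 := Nat.le_self_pow (by norm_num) b
  have hb5 : b ≤ b ^ 5 := Nat.le_self_pow (by norm_num) b
  exact .forLoop hρ (by omega) (by omega) (fun _ _ _ hM => eval_rows hI hM) hP

theorem IsInput.one_le (hI : IsInput I m n k b) : 1 ≤ b := (hI.htLe 0 0).one_le

theorem IsInput.htLe_mono (hI : IsInput I m n k b) {q : ℚ} {C d : ℕ} (hq : HtLe q (C * b ^ d))
    (hC : C ≤ 31) (hd : d ≤ 5) : HtLe q (31 * b ^ 5) :=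
  hq.mono (Nat.mul_le_mul hC (Nat.pow_le_pow_right hI.one_le hd))

theorem IsInput.htLe_sum_row (hI : IsInput I m n k b) {i : ℕ} (hi : i ≤ n) :
    HtLe (∑ l ∈ range i, I 1 l) (b ^ 2) := by
  rw [sq]
  exact .sum_range (hi.trans_lt hI.cols_lt) (fun l _ => hI.htLe 1 l) hI.one_le

theorem countProg_spec (hI : IsInput I m n k b) : Transforms I b z [] countProg z [(k : ℚ)] := by
  have init : Transforms I b z [] (.setReg 0 0) z [∑ l ∈ range 0, I 1 l] :=
    .setReg le_rfl rfl (hI.htLe_mono (C := 1) (by simpa using hI.htLe_sum_row n.zero_le)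
      (by norm_num) (by norm_num)) fun M _ => by simp [eval_zero]
  rw [← hI.row_sum]
  refine init.seq (forLoop_cols hI (Z := fun _ => z) (ρ := fun i => [∑ l ∈ range i, I 1 l])
    (fun _ => rfl) fun i hi => ?_)
  refine .setReg (by simp) rfl (hI.htLe_mono (C := 1) (by simpa using hI.htLe_sum_row hi)
      (by norm_num) (by norm_num)) fun M hM => ?_
  simp [eval_add, hM.eval_reg, hM.eval_get_input, sum_range_succ]

theorem update_startPoint (x : ℕ → ℚ) (k i : ℕ) :
    update (startPoint x k i) i (x i / 2 + 1 / (2 * k)) = startPoint x k (i + 1) := by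
  ext l
  simp only [startPoint, update_apply]
  grind

theorem IsInput.htLe_startPoint (hI : IsInput I m n k b) (i l : ℕ) :
    HtLe (startPoint (I 3) k i l) (8 * b ^ 2) :=
  RoundingProgram.htLe_startPoint (hI.htLe 3) (hI.row_sum ▸ hI.htLe_sum_row le_rfl) i l

theorem startProg_spec (hI : IsInput I m n k b) :
    Transforms I b 0 [(k : ℚ)] startProg (startPoint (I 3) k n)
      [(k : ℚ), objective (I 2) (startPoint (I 3) k n) n] := by
  have objective_htLe {i : ℕ} (hi : i ≤ n) :
      HtLe (objective (I 2) (startPoint (I 3) k n) i) (31 * b ^ 5) :=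
    hI.htLe_mono (htLe_objective (hI.htLe 2) (hI.htLe_startPoint n) (hi.trans_lt hI.cols_lt))
      (by norm_num) (by norm_num)
  have init : Transforms I b (startPoint (I 3) k 0) [(k : ℚ)] (.setReg 1 0)
      (startPoint (I 3) k 0) [(k : ℚ), objective (I 2) (startPoint (I 3) k n) 0] :=
    .setReg le_rfl rfl (objective_htLe n.zero_le) fun M _ => by simp [eval_zero, objective]
  refine init.seq (forLoop_cols hI (Z := startPoint (I 3) k)
    (ρ := fun i => [(k : ℚ), objective (I 2) (startPoint (I 3) k n) i]) (fun _ => rfl)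
    fun i hi => ?_)
  have point_htLe : HtLe (I 3 i / 2 + 1 / (2 * k)) (31 * b ^ 5) :=
    hI.htLe_mono (by simpa [startPoint] using hI.htLe_startPoint (i + 1) i)
      (by norm_num) (by norm_num)
  rw [← update_startPoint]
  refine (HoareTriple.setPoint point_htLe (i := i) (fun M hM => ?_) fun M hM => ?_).seq
    (.setReg (by simp) rfl (objective_htLe hi) fun M hM => ?_)
  · simp [hM.eval_reg]
  · simp [eval_add, eval_mul, eval_div, eval_one, eval_two, hM.eval_reg, hM.eval_get_input]
  · simp [eval_add, eval_mul, hM.eval_reg, hM.eval_get_input, hM.eval_get_point, objective,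
      sum_range_succ, startPoint, hi]

theorem IsInput.ceilLog_le (hI : IsInput I m n k b) {v : ℚ} (hv : HtLe v (9 * b ^ 3)) :
    ceilLog (2 * m / v : ℚ) ≤ 20 * b ^ 3 := by
  have two_mul_rows : HtLe (2 * m : ℚ) (1 + b) :=
    HtLe.mul (by simpa using HtLe.natCast (n := 2) le_rfl (by norm_num))
      (hI.rows_eq ▸ hI.htLe 0 0)
  have hb3 : b ≤ b ^ 3 := Nat.le_self_pow (by norm_num) b
  have hb := hI.one_le
  exact ceilLog_le_iff.mpr <| (le_abs_self _).trans
    ((two_mul_rows.div hv).mono (by omega)).abs_le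

theorem exponentProg_spec (hI : IsInput I m n k b) {q v : ℚ} (hv : HtLe v (9 * b ^ 3)) :
    Transforms I b z [q, v] exponentProg z
      [q, v, (ceilLog (2 * m / v) : ℕ), 2 ^ ceilLog (2 * m / v)] := by
  have hbound := hI.ceilLog_le hv
  set s := ceilLog (2 * m / v) with hs
  have hpos : 1 ≤ 20 * b ^ 3 := Nat.mul_pos (by norm_num) (Nat.pow_pos hI.one_le)
  have exponent_htLe {i : ℕ} (hi : i ≤ s) : HtLe i (31 * b ^ 5) :=
    hI.htLe_mono (.natCast hpos ((hi.trans hbound).trans Nat.lt_two_pow_self.le))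
      (by norm_num) (by norm_num)
  have power_htLe {i : ℕ} (hi : i ≤ s) : HtLe (2 ^ i) (31 * b ^ 5) := by
    refine hI.htLe_mono (C := 20) (d := 3) ?_ (by norm_num) (by norm_num)
    exact_mod_cast HtLe.natCast (n := 2 ^ i) hpos (Nat.pow_le_pow_right two_pos (hi.trans hbound))
  have init_exponent : Transforms I b z [q, v] (.setReg 2 0) z [q, v, (0 : ℕ)] :=
    .setReg le_rfl rfl (exponent_htLe s.zero_le) fun M _ => by simp [eval_zero]
  have init_power : Transforms I b z [q, v, (0 : ℕ)] (.setReg 3 1) z [q, v, (0 : ℕ), 2 ^ 0] :=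
    .setReg le_rfl rfl (power_htLe s.zero_le) fun M _ => by simp [eval_one]
  have test (i : ℕ) (M : Memory) (hM : Holds (31 * b ^ 5) I z [q, v, (i : ℚ), 2 ^ i] M) :
      (Expr.lt (.reg 3) (2 * rows / .reg 1)).eval M = 0 ↔ s ≤ i := by
    rw [hs, ceilLog_le_iff]
    simp [eval_lt, eval_div, eval_mul, eval_two, eval_rows hI hM, hM.eval_reg]
  have body (i : ℕ) (hi : i < s) : Transforms I b z [q, v, (i : ℚ), 2 ^ i]
      (.seq (.setReg 2 (.reg 2 + 1)) (.setReg 3 (2 * .reg 3))) z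
      [q, v, ((i + 1 : ℕ) : ℚ), 2 ^ (i + 1)] :=
    .seq (.setReg (by simp) rfl (exponent_htLe hi) fun M hM => by
      simp [eval_add, eval_one, hM.eval_reg]) <|
    .setReg (by simp) rfl (power_htLe hi) fun M hM => by
      simp [eval_mul, eval_two, hM.eval_reg, pow_succ']
  refine init_exponent.seq (init_power.seq (.loop ?_ (fun i M hM => hM.htLe) test body))
  exact hbound

theorem rowWeightProg_spec (hI : IsInput I m n k b) {q v T S : ℚ} {s i j : ℕ}
    (hz : ∀ l, HtLe (z l) (8 * b ^ 2)) (hs : HtLe s (20 * b ^ 3)) :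
    Transforms I b z [q, v, s, T, i, S, j] rowWeightProg z
      [q, v, s, T, i, S, j, rowWeight (inputMatrix I n j) z s n] := by
  have weight_htLe {l : ℕ} (hl : l ≤ n) :
      HtLe (rowWeight (inputMatrix I n j) z s l) (31 * b ^ 5) :=
    hI.htLe_mono (htLe_rowWeight (fun _ => hI.htLe 1 _) hz hs (hl.trans_lt hI.cols_lt))
      (by norm_num) (by norm_num)
  have init : Transforms I b z [q, v, s, T, i, S, j] (.setReg 7 1) z
      [q, v, s, T, i, S, j, rowWeight (inputMatrix I n j) z s 0] :=
    .setReg le_rfl rfl (weight_htLe n.zero_le) fun M _ => by simp [eval_one, rowWeight]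
  refine init.seq (forLoop_cols hI (Z := fun _ => z)
    (ρ := fun l => [q, v, s, T, i, S, j, rowWeight (inputMatrix I n j) z s l]) (fun _ => rfl)
    fun l hl => .setReg (by simp) rfl (weight_htLe hl) fun M hM => ?_)
  have hentry : (entry 6 8).eval M = inputMatrix I n j l :=
    eval_entry hI hM (by simp) (by simp) rfl rfl
  simp [eval_add, eval_mul, eval_one, hentry, hM.eval_reg, hM.eval_get_point, rowWeight,
    prod_range_succ]

theorem congestionProg_spec (hI : IsInput I m n k b) {q v T : ℚ} {s i : ℕ}
    (hz : ∀ l, HtLe (z l) (8 * b ^ 2)) (hs : HtLe s (20 * b ^ 3)) :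
    Transforms I b z [q, v, s, T, i] congestionProg z
      [q, v, s, T, i, congestion (inputMatrix I n) z m n s i] := by
  have congestion_htLe {j : ℕ} (hj : j ≤ m) :
      HtLe (congestion (inputMatrix I n) z j n s i) (31 * b ^ 5) :=
    htLe_congestion (fun _ _ => hI.htLe 1 _) hz hs (hj.trans_lt hI.rows_lt) hI.cols_lt i
  have init : Transforms I b z [q, v, s, T, i] (.setReg 5 0) z
      [q, v, s, T, i, congestion (inputMatrix I n) z 0 n s i] :=
    .setReg le_rfl rfl (congestion_htLe m.zero_le) fun M _ => by simp [eval_zero, congestion]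
  refine init.seq (forLoop_rows hI (Z := fun _ => z)
    (ρ := fun j => [q, v, s, T, i, congestion (inputMatrix I n) z j n s i]) (fun _ => rfl)
    fun j hj => (rowWeightProg_spec hI hz hs).seq ?_)
  have add_term : Transforms I b z
      [q, v, s, T, i, congestion (inputMatrix I n) z j n s i, j,
        rowWeight (inputMatrix I n j) z s n]
      (.setReg 5 (.reg 5 + entry 6 4 * .reg 7)) z
      ([q, v, s, T, i, congestion (inputMatrix I n) z (j + 1) n s i, j] ++
        [rowWeight (inputMatrix I n j) z s n]) := by
    refine .setReg (by simp) rfl (congestion_htLe hj) fun M hM => ?_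
    have hentry : (entry 6 4).eval M = inputMatrix I n j i :=
      eval_entry hI hM (by simp) (by simp) rfl rfl
    simp [eval_add, eval_mul, hentry, hM.eval_reg, congestion, sum_range_succ]
  exact add_term.weaken fun M hM => hM.of_append

theorem htLe_update {g : ℕ} (hz : ∀ l, HtLe (z l) g) (i : ℕ) {q : ℚ} (hq : HtLe q g) (l : ℕ) :
    HtLe (update z i q l) g := by
  rw [update_apply]
  split_ifs
  exacts [hq, hz l]

theorem htLe_roundSeq {g : ℕ} (a : ℕ → ℕ → ℚ) (c : ℕ → ℚ) (m n s : ℕ) (hz : ∀ l, HtLe (z l) g)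
    (i l : ℕ) : HtLe (roundSeq a c m n s z i l) g := by
  induction i generalizing l with
  | zero => exact hz l
  | succ i ih => exact htLe_update ih i (.ite_one_zero (hz 0).one_le) l

theorem roundProg_spec (hI : IsInput I m n k b) {q v : ℚ} {s : ℕ}
    (hz : ∀ l, HtLe (z l) (8 * b ^ 2)) (hs : HtLe s (20 * b ^ 3)) :
    Transforms I b z [q, v, s, 2 ^ s] roundProg (roundSeq (inputMatrix I n) (I 2) m n s z n)
      [q, v, s, 2 ^ s] := by
  have hpos : 1 ≤ 31 * b ^ 5 := Nat.mul_pos (by norm_num) (Nat.pow_pos hI.one_le)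
  refine forLoop_cols hI (Z := roundSeq (inputMatrix I n) (I 2) m n s z)
    (ρ := fun _ => [q, v, s, 2 ^ s]) (fun _ => rfl) fun i _ => ?_
  set y := roundSeq (inputMatrix I n) (I 2) m n s z i
  have clear : Transforms I b y [q, v, s, 2 ^ s, i] (.assign 4 (.reg 4) 0) (update y i 0)
      [q, v, s, 2 ^ s, i] :=
    .setPoint (.zero hpos) (fun M hM => by simp [hM.eval_reg]) fun M _ => eval_zero M
  have hcleared : ∀ l, HtLe (update y i 0 l) (8 * b ^ 2) :=
    htLe_update (htLe_roundSeq _ _ m n s hz i) i (.zero (hz 0).one_le)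
  have decide_coordinate : Transforms I b (update y i 0)
      [q, v, s, 2 ^ s, i, congestion (inputMatrix I n) (update y i 0) m n s i]
      (.assign 4 (.reg 4) (.lt (.reg 5) (.get 2 (.reg 4) * (.reg 3 * .reg 3 * .reg 3))))
      (update (update y i 0) i (roundedCoordinate (inputMatrix I n) (I 2) m n s y i))
      ([q, v, s, 2 ^ s, i] ++ [congestion (inputMatrix I n) (update y i 0) m n s i]) := by
    have hcube : (2 ^ s * 2 ^ s * 2 ^ s : ℚ) = 8 ^ s := by
      rw [← mul_pow, ← mul_pow]
      norm_num
    refine .setPoint (.ite_one_zero hpos) (fun M hM => ?_) fun M hM => ?_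
    · simp [hM.eval_reg]
    · simp [eval_lt, eval_mul, hM.eval_reg, hM.eval_get_input, hcube, roundedCoordinate]
  rw [update_idem] at decide_coordinate
  exact clear.seq ((congestionProg_spec hI hcleared hs).seq
    (decide_coordinate.weaken fun M hM => hM.of_append))

theorem program_spec (hI : IsInput I m n k b) :
    Transforms I b 0 [] program (greedyRounding (inputMatrix I n) (I 2) (I 3) m n k)
      [(k : ℚ), objective (I 2) (startPoint (I 3) k n) n,
        (roundingParameter (I 2) (I 3) m n k : ℕ), 2 ^ roundingParameter (I 2) (I 3) m n k] := by
  have hv := htLe_objective (hI.htLe 2) (hI.htLe_startPoint n) hI.cols_lt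
  have hs : HtLe (roundingParameter (I 2) (I 3) m n k) (20 * b ^ 3) :=
    .natCast (Nat.mul_pos (by norm_num) (Nat.pow_pos hI.one_le))
      ((hI.ceilLog_le hv).trans Nat.lt_two_pow_self.le)
  exact (countProg_spec hI).seq ((startProg_spec hI).seq
    ((exponentProg_spec hI hv).seq (roundProg_spec hI (hI.htLe_startPoint n) hs)))

end

end RoundingProgram

/-! ### Rounding by the program -/

section Input

variable {m n : ℕ} (A : BoolMat m n) (c x : Fin n → ℚ)

theorem inputMemory_entry (i : Fin m) (j : Fin n) :
    inputMemory A c x 1 (i * n + j) = if A i j then 1 else 0 := by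
  have index_eq : (finProdFinEquiv (i, j) : ℕ) = i * n + j := by
    rw [finProdFinEquiv_apply_val]
    ring
  have index_lt : (i * n + j : ℕ) < m * n := index_eq ▸ (finProdFinEquiv (i, j)).2
  have index_eq' : (⟨i * n + j, index_lt⟩ : Fin (m * n)) = finProdFinEquiv (i, j) :=
    Fin.ext index_eq.symm
  simp only [inputMemory, index_lt, dif_pos, index_eq', Equiv.symm_apply_apply]

theorem inputMatrix_inputMemory (i : Fin m) (j : Fin n) :
    RoundingProgram.inputMatrix (inputMemory A c x) n i j = if A i j then 1 else 0 :=
  inputMemory_entry A c x i j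

theorem htLe_inputMemory (a l : ℕ) : HtLe (inputMemory A c x a l) (inputLength A c x + 1) := by
  have hone : 1 ≤ inputLength A c x + 1 := Nat.le_add_left _ _
  have natCast {d : ℕ} (hd : d ≤ inputLength A c x) : HtLe d (inputLength A c x + 1) :=
    .natCast hone (by have := (inputLength A c x).lt_two_pow_self; rw [pow_succ]; omega)
  have bitLength_le_sum (v : Fin n → ℚ) (j : Fin n) : bitLength (v j) ≤ ∑ j, bitLength (v j) :=
    Finset.single_le_sum (f := fun j => bitLength (v j)) (fun _ _ => Nat.zero_le _)
      (Finset.mem_univ j)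
  unfold inputMemory
  split
  · split_ifs
    exacts [natCast (by unfold inputLength; omega), natCast (by unfold inputLength; omega),
      .zero hone]
  · split_ifs
    exacts [.one hone, .zero hone, .zero hone]
  · split_ifs with h
    · have := bitLength_le_sum c ⟨l, h⟩
      exact .of_bitLength_le (by unfold inputLength; omega)
    · exact .zero hone
  · split_ifs with h
    · have := bitLength_le_sum x ⟨l, h⟩
      exact .of_bitLength_le (by unfold inputLength; omega)
    · exact .zero hone
  · exact .zero hone

theorem exists_isInput_inputMemory :
    ∃ k, RoundingProgram.IsInput (inputMemory A c x) m n k (inputLength A c x + 1) := by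
  have natCast_entry (l : ℕ) :
      ((if inputMemory A c x 1 l = 1 then 1 else 0 : ℕ) : ℚ) = inputMemory A c x 1 l := by
    simp only [inputMemory]
    split_ifs <;> simp_all
  refine ⟨∑ l ∈ Finset.range n, if inputMemory A c x 1 l = 1 then 1 else 0,
    by simp [inputMemory], by simp [inputMemory], ?_, htLe_inputMemory A c x,
    by unfold inputLength; omega, by unfold inputLength; omega⟩
  rw [Nat.cast_sum]
  exact (Finset.sum_congr rfl fun l _ => natCast_entry l).symm

end Input

namespace RoundingProgram

theorem outputs_program {m n k : ℕ} {A : BoolMat m n} {c x : Fin n → ℚ}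
    (hI : IsInput (inputMemory A c x) m n k (inputLength A c x + 1)) (ω : ℕ → Bool) :
    ∃ t ≤ program.weight * ((31 * (inputLength A c x + 1) ^ 5 + 1) *
        (20 * (inputLength A c x + 1) ^ 3 + 1) ^ program.depth),
      Outputs program ω A c x t fun j => greedyRounding (inputMatrix (inputMemory A c x) n)
        (inputMemory A c x 2) (inputMemory A c x 3) m n k j := by
  have initial : Holds (31 * (inputLength A c x + 1) ^ 5) (inputMemory A c x) 0 []
      (inputMemory A c x) :=
    ⟨fun _ _ => rfl, rfl, fun r hr => absurd hr r.not_lt_zero,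
      fun a l => hI.htLe_mono (C := 1) (d := 1) (by simpa using hI.htLe a l)
        (by norm_num) (by norm_num)⟩
  obtain ⟨t, M, hrun, ht, hM⟩ := program_spec hI _ initial ω 0
  exact ⟨t, ht, ⟨M, 0⟩, hrun, fun j => congrFun hM.point j⟩

theorem runsInPolyTime_program : RunsInPolyTime program := by
  refine ⟨.C program.weight * ((31 * (.X + 1) ^ 5 + 1) * (20 * (.X + 1) ^ 3 + 1) ^ program.depth),
    fun m n A c x ω => ?_⟩
  obtain ⟨k, hI⟩ := exists_isInput_inputMemory A c x
  obtain ⟨t, ht, hout⟩ := outputs_program hI ω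
  exact ⟨t, _, hout, by simpa using ht⟩

end RoundingProgram

section Rounding

variable {m n k : ℕ} {p : ℝ} (hk : 1 ≤ k) (hp : 0 < p)
  (hload : Real.exp 1 < load m n k p + Real.log m) {A : BoolMat m n}
include hk hp hload

theorem exists_isGoodRounding (hA : ∀ i, (Finset.univ.filter fun j => A i j = true).card ≤ k)
    {c x : Fin n → ℝ} (hcx : Feasible A p c x) :
    ∃ y, IsGoodRounding A (400 * errorBound m n k p) (1 / 4) c x y := by
  set c' : ℕ → ℝ := Function.extend Fin.val c 0
  set x' : ℕ → ℝ := Function.extend Fin.val x 0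
  have hc : (fun j : Fin n => c' j) = c := funext fun j => Fin.val_injective.extend_apply c 0 j
  have hx : (fun j : Fin n => x' j) = x := funext fun j => Fin.val_injective.extend_apply x 0 j
  have ha (i : Fin m) (j : Fin n) : Function.extend Fin.val
      (fun i => Function.extend Fin.val (fun j => if A i j then 1 else 0) 0) 0 (i : ℕ) (j : ℕ) =
      if A i j then (1 : ℝ) else 0 := by
    rw [Fin.val_injective.extend_apply, Fin.val_injective.extend_apply]
  have hcx' : Feasible A p (fun j => RingHom.id ℝ (c' j)) (fun j => RingHom.id ℝ (x' j)) := by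
    simpa only [RingHom.id_apply, hc, hx] using hcx
  have hgood := isGoodRounding_greedyRounding strictMono_id hp hcx' hk hload ha hA
  simp only [RingHom.id_apply, hc, hx] at hgood
  exact ⟨_, hgood⟩

theorem exists_outputs_isGoodRounding (hA : ∀ i, A i ∈ rowsWith n k) {c x : Fin n → ℚ}
    (hcx : Feasible A p (fun j => (c j : ℝ)) (fun j => (x j : ℝ))) (ω : ℕ → Bool) :
    ∃ (t : ℕ) (y : Fin n → ℚ), Outputs RoundingProgram.program ω A c x t y ∧
      IsGoodRounding A (400 * errorBound m n k p) (1 / 4)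
        (fun j => (c j : ℝ)) (fun j => (x j : ℝ)) (fun j => (y j : ℝ)) := by
  obtain ⟨k', hI⟩ := exists_isInput_inputMemory A c x
  obtain rfl : k' = k := by
    have hm : 0 < m := by
      rw [Nat.pos_iff_ne_zero]
      rintro rfl
      have hlog := log_two_le_log_of_exp_one_lt hload
      rw [Nat.cast_zero, Real.log_zero] at hlog
      exact hlog.not_gt (Real.log_pos one_lt_two)
    have row_sum := sum_row_eq_card (inputMatrix_inputMemory A c x) ⟨0, hm⟩
    simp only [RoundingProgram.inputMatrix, zero_mul, zero_add] at row_sum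
    rw [hI.row_sum, hA ⟨0, hm⟩] at row_sum
    exact_mod_cast row_sum
  obtain ⟨t, -, hout⟩ := RoundingProgram.outputs_program hI ω
  have hc (j : Fin n) : inputMemory A c x 2 j = c j := by simp [inputMemory]
  have hx (j : Fin n) : inputMemory A c x 3 j = x j := by simp [inputMemory]
  have hcx' : Feasible A p (fun j => Rat.castHom ℝ (inputMemory A c x 2 j))
      (fun j => Rat.castHom ℝ (inputMemory A c x 3 j)) := by
    simpa only [Rat.coe_castHom, hc, hx] using hcx
  refine ⟨t, _, hout, ?_⟩
  simpa only [Rat.coe_castHom, hc, hx] using isGoodRounding_greedyRounding Rat.cast_strictMono hp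
    hcx' hk hload (inputMatrix_inputMemory A c x) fun i => (hA i).le

end Rounding

/-! ### Random matrices -/

section RandomMatrix

variable {m n k : ℕ}

theorem rowsWith_nonempty (hkn : k ≤ n) : (rowsWith n k).Nonempty := by
  obtain ⟨s, -, hs⟩ := Finset.exists_subset_card_eq (s := (Finset.univ : Finset (Fin n)))
    (by simpa using hkn)
  exact ⟨fun j => decide (j ∈ s), by simpa [rowsWith] using hs⟩

theorem isProbabilityMeasure_randomMatrix (m : ℕ) (hkn : k ≤ n) :
    IsProbabilityMeasure (randomMatrix m n k) := by
  have := isProbabilityMeasure_uniformOn (Set.toFinite _) (rowsWith_nonempty hkn)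
  unfold randomMatrix
  infer_instance

theorem randomMatrix_forall_mem_rowsWith (m : ℕ) (hkn : k ≤ n) :
    randomMatrix m n k {A | ∀ i, A i ∈ rowsWith n k} = 1 := by
  have := isProbabilityMeasure_uniformOn (Set.toFinite _) (rowsWith_nonempty hkn)
  have eq_pi : {A : BoolMat m n | ∀ i, A i ∈ rowsWith n k} =
      Set.univ.pi fun _ => rowsWith n k := by
    ext A
    simp
  simp [randomMatrix, eq_pi, Measure.pi_pi, uniformOn_self (Set.toFinite _) (rowsWith_nonempty hkn)]

instance isProbabilityMeasure_fairCoins : IsProbabilityMeasure fairCoins := by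
  have : IsProbabilityMeasure (uniformOn (Set.univ : Set Bool)) :=
    isProbabilityMeasure_uniformOn Set.finite_univ Set.univ_nonempty
  unfold fairCoins
  infer_instance

theorem one_sub_one_div_le_measureReal {Ω : Type*} [MeasurableSpace Ω] {μ : Measure Ω}
    [IsProbabilityMeasure μ] {s t : Set Ω} (hs : μ s = 1) (hst : s ⊆ t) (m : ℕ) :
    1 - 1 / (m : ℝ) ≤ μ.real t :=
  calc 1 - 1 / (m : ℝ) ≤ 1 := sub_le_self _ (by positivity)
    _ = μ.real s := by rw [measureReal_def, hs, ENNReal.toReal_one]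
    _ ≤ μ.real t := measureReal_mono hst

end RandomMatrix

theorem mainTheorem1_general :
    ∃ C : ℝ, 0 < C ∧ ∃ α : ℝ, 0 < α ∧
      (∀ (m n k : ℕ) (p : ℝ), 1 ≤ k → 0 < p → Real.exp 1 < load m n k p + Real.log m →
        ∀ A : BoolMat m n, (∀ i, (Finset.univ.filter fun j => A i j = true).card ≤ k) →
          ∀ c x : Fin n → ℝ, Feasible A p c x →
            ∃ y : Fin n → ℝ, IsGoodRounding A (C * errorBound m n k p) α c x y) ∧
      ∃ P : Prog, RunsInPolyTime P ∧
        ∀ (m n k : ℕ) (p : ℝ), 1 ≤ k → 0 < p → Real.exp 1 < load m n k p + Real.log m →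
          ∀ A : BoolMat m n, (∀ i, A i ∈ rowsWith n k) →
            ∀ c x : Fin n → ℚ, Feasible A p (fun j => (c j : ℝ)) (fun j => (x j : ℝ)) →
              ∀ ω : ℕ → Bool, ∃ (t : ℕ) (y : Fin n → ℚ), Outputs P ω A c x t y ∧
                IsGoodRounding A (C * errorBound m n k p) α
                  (fun j => (c j : ℝ)) (fun j => (x j : ℝ)) (fun j => (y j : ℝ)) :=
  ⟨400, by norm_num, 1 / 4, by norm_num,
    fun _ _ _ _ hk hp hload _ hA _ _ hcx => exists_isGoodRounding hk hp hload hA hcx,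
    RoundingProgram.program, RoundingProgram.runsInPolyTime_program,
    fun _ _ _ _ hk hp hload _ hA _ _ hcx => exists_outputs_isGoodRounding hk hp hload hA hcx⟩

theorem mainTheorem1 :
    ∃ C : ℝ, 0 < C ∧ ∃ α : ℝ, 0 < α ∧
      -- existence of the rounding, for real data
      (∀ (m n k : ℕ) (p : ℝ), 1 ≤ k → k ≤ n → 0 < p →
        Real.exp 1 < load m n k p + Real.log m →
        1 - 1 / (m : ℝ) ≤ (randomMatrix m n k).real
          {A | ∀ c x : Fin n → ℝ, Feasible A p c x →
            ∃ y : Fin n → ℝ, IsGoodRounding A (C * errorBound m n k p) α c x y}) ∧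
      -- computation of the rounding in randomized polynomial time, for rational data
      ∃ P : Prog, RunsInPolyTime P ∧
        ∀ (m n k : ℕ) (p : ℝ), 1 ≤ k → k ≤ n → 0 < p →
          Real.exp 1 < load m n k p + Real.log m →
          ∀ c x : BoolMat m n → Fin n → ℚ,
            (∀ A : BoolMat m n, (∀ i, A i ∈ rowsWith n k) →
              Feasible A p (fun j => (c A j : ℝ)) (fun j => (x A j : ℝ))) →
            1 - 1 / (m : ℝ) ≤ ((randomMatrix m n k).prod fairCoins).real
              {z | ∃ (t : ℕ) (y : Fin n → ℚ), Outputs P z.2 z.1 (c z.1) (x z.1) t y ∧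
                IsGoodRounding z.1 (C * errorBound m n k p) α
                  (fun j => (c z.1 j : ℝ)) (fun j => (x z.1 j : ℝ)) (fun j => (y j : ℝ))} := by
  obtain ⟨C, hC, α, hα, hexists, P, hP, houtputs⟩ := mainTheorem1_general
  refine ⟨C, hC, α, hα, fun m n k p hk hkn hp hload => ?_, P, hP,
    fun m n k p hk hkn hp hload c x hcx => ?_⟩
  · have := isProbabilityMeasure_randomMatrix m hkn
    refine one_sub_one_div_le_measureReal (randomMatrix_forall_mem_rowsWith m hkn) ?_ m
    exact fun A hA => hexists m n k p hk hp hload A fun i => (hA i).le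
  · have := isProbabilityMeasure_randomMatrix m hkn
    have rows_eq_one : ((randomMatrix m n k).prod fairCoins)
        ({A | ∀ i, A i ∈ rowsWith n k} ×ˢ Set.univ) = 1 := by
      rw [Measure.prod_prod, randomMatrix_forall_mem_rowsWith m hkn, measure_univ, one_mul]
    refine one_sub_one_div_le_measureReal rows_eq_one ?_ m
    rintro ⟨A, ω⟩ ⟨hA, -⟩
    exact houtputs m n k p hk hp hload A hA _ _ (hcx A hA) ω
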